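/- **Setting.** There are $K$ base arms and $T$ rounds; a decision vector is $\mathbf x\in\mathcal X=\{\mathbf x\in\{0,1\}^K:\|\mathbf x\|_0\le m\}$. In round $t$ the instantaneous rewards $\mathbf b_t\in[0,1]^K$ are independent of the past and $b_{k,t}$ has law $\theta_{k,t}$; $\mathbf W_t$ is the nonnegative weighted adjacency matrix of a directed acyclic graph. Playing $\mathbf x_t$ gives the observations $\mathbf z_t=\operatorname{diag}(\mathbf b_t)\mathbf x_t$ and $\mathbf y_t=(\mathbf I-\mathbf W_t)^{-1}\mathbf z_t$ and the payoff $\mathbf c^\top\mathbf y_t$ with $\mathbf c\in\{0,1\}^K$; let $\psi_t(\mathbf x)$ be the expected payoff of $\mathbf x$, $\mathbf x^*_t$ a maximizer of $\psi_t$ over $\mathcal X$, and $\mathcal R(T)=\mathbb E\big[\sum_{t=1}^T(\psi_t(\mathbf x_t^*)-\psi_t(\mathbf x_t))\big]$. Let $\Delta_{\max}$ and $\Delta_{\min}$ be the largest and the smallest value of $\psi_t(\mathbf x_t^*)-\psi_t(\mathbf x)$ over all $t\le T$ and all suboptimal $\mathbf x\in\mathcal X$. **Algorithm (PS-SEM-UCB-Gr).**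 Given a partition of the arms into groups, $p$, $\delta$, a threshold function $\gamma$, $\lambda_1\ge0$ and $\epsilon\ge 0$. * *Graph learning phase:* the algorithm starts with $K$ rounds in which it plays the columns of an initialization matrix; these columns lie in $\mathcal X$ and play every arm at least once. At the end of the phase it computes an estimate $\hat{\mathbf W}$ minimizing $\|\mathbf Y-\mathbf V\mathbf Y-\mathbf Z\|_F^2+\lambda_1\|\mathbf V\|_1$ over the matrices $\mathbf V$ with zero diagonal, where the columns of $\mathbf Y,\mathbf Z$ are the feedback stored since the phase began. * *Normal rounds:* if the queue $\Omega$ (initially empty) is nonempty, some $a\in\Omega$ is removed and any $\mathbf x_t\in\mathcal X$ containing $a$ is played (forced play); otherwise $\mathbf x_t$ maximizes $\mathbf c^\top(\mathbf I-\hat{\mathbf W}_{t-1})^{-1}\operatorname{diag}(\mathbf U_{t-1})\mathbf x$ over $\mathcal X$. Afterwards, if $\|\mathbf y_t-\hat{\mathbf W}_{t-1}\mathbf y_t-\mathbf z_t\|_2^2>\epsilon$, the stored feedback is dropped and a new graph learning phase starts; otherwise the feedback is stored and $\hat{\mathbf W}_t$ is recomputed. * *Every round:* the generalized likelihood ratio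 detector with threshold $\gamma(n,\delta)$ is run on the $n$ samples of each played arm since its last restart; if it raises an alarm, the statistics of all arms $k$ of its group are restarted (restart time $\tau_k=t$) and the group is added to $\Omega$. The index $U_{k,t}=\hat\mu_{k,t}+\sqrt{(m+1)\log(t-\tau_k)/n_{k,t}}$ is updated from the samples since $\tau_k$ whenever their number $n_{k,t}$ is nonzero. In addition, whenever the number of rounds since the last alarm (or since the start) is a positive multiple of $\lfloor K/p\rfloor$ in a normal round, all arms are put into $\Omega$. It is assumed that the data of a completed graph learning phase identify the graph: almost surely the true adjacency matrix is the only solution of the estimation problem on these data. **Lemma.** Let $\omega_t^\top=\mathbf c^\top(\mathbf I-\hat{\mathbf W}_{t-1})^{-1}\operatorname{diag}(\mathbf x_t)$ and let $\omega_{\max}$ be the (essential) maximum of $\omega_{k,t}$ over all arms $k$ and all rounds $K<t\le T$ (and $0$ if $T\le K$). Put $$B=\frac{4\,\omega_{\max}^2\,m^2(m+1)\,K\log T}{\Delta_{\min}^2}+\frac{\pi^2}{3}mK+K .$$ In the stationary case $N_\Theta=1$, $N_{\mathbf W}=1$ (no $\theta_{k,t}$ and no $\mathbf W_t$ changes in the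 rounds $1,\dots,T$): 1. if almost surely no detector raises a (false) alarm and no forced play occurs up to round $T$, then $\mathcal R(T)\le B\,\Delta_{\max}$; 2. in general, $\mathcal R(T)\le\big(B+\mathbb E[\text{number of forced plays up to round }T]+T\cdot\mathbb P(\text{some detector raises an alarm up to round }T)\big)\Delta_{\max}$. (If no $\mathbf x\in\mathcal X$ is suboptimal, then $\mathcal R(T)=0$ and the right-hand sides are read as $0$.) In particular the bound does not involve the number of layers of the causal graph. -/

import Mathlib

open MeasureTheory ProbabilityTheory Matrix

noncomputable section

namespace SemBandit

/-! ## The environment -/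

/-- The decision vector in `{0,1}^K` of a super arm. -/
def vec {K : ℕ} (I : Finset (Fin K)) : Fin K → ℝ := fun k => if k ∈ I then 1 else 0

/-- The feasible super arms: at most `m` base arms. -/
def feasible (K m : ℕ) : Finset (Finset (Fin K)) := Finset.univ.filter fun I => I.card ≤ m

theorem feasible_nonempty (K m : ℕ) : (feasible K m).Nonempty :=
  ⟨∅, by simp [feasible]⟩

/-- The directed graph with an edge `j → i` whenever `W i j ≠ 0` has no directed cycle
(in particular no self-loop). -/
def IsDAG {K : ℕ} (W : Matrix (Fin K) (Fin K) ℝ) : Prop :=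
  ∀ i, ¬ Relation.TransGen (fun j i => W i j ≠ 0) i i

/-- A combinatorial semi-bandit with causally related rewards: budget `m`, horizon `T`, indicator
vector `c` of the nodes of interest, instantaneous rewards `b t` and weighted adjacency
matrices `W t` in the rounds `t = 1, …, T`. -/
structure Bandit (K : ℕ) (Ω : Type*) where
  m : ℕ
  T : ℕ
  c : Fin K → ℝ
  b : ℕ → Ω → Fin K → ℝ
  W : ℕ → Matrix (Fin K) (Fin K) ℝ

/-- Exogenous input `z = diag(b) x`. -/
def exoInput {K : ℕ} (b : Fin K → ℝ) (I : Finset (Fin K)) : Fin K → ℝ :=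
  Matrix.diagonal b *ᵥ vec I

/-- Endogenous output `y = (1 - W)⁻¹ diag(b) x`, the solution of `y = W y + z`. -/
def endoOutput {K : ℕ} (W : Matrix (Fin K) (Fin K) ℝ) (b : Fin K → ℝ) (I : Finset (Fin K)) :
    Fin K → ℝ :=
  (1 - W)⁻¹ *ᵥ exoInput b I

namespace Bandit

variable {K : ℕ} {Ω : Type*} [MeasurableSpace Ω] (E : Bandit K Ω) (P : Measure Ω)

/-- The standing assumptions on the environment. The filtration `ℱ t` is the information available
after round `t`; it may also contain the internal randomness of the agent. The arms of one
round may be dependent. -/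
structure IsValid (ℱ : Filtration ℕ ‹MeasurableSpace Ω›) : Prop where
  c_mem : ∀ k, E.c k = 0 ∨ E.c k = 1
  W_nonneg : ∀ t ∈ Finset.Icc 1 E.T, ∀ i j, 0 ≤ E.W t i j
  W_dag : ∀ t ∈ Finset.Icc 1 E.T, IsDAG (E.W t)
  b_mem : ∀ t ∈ Finset.Icc 1 E.T, ∀ᵐ ω ∂P, ∀ k, E.b t ω k ∈ Set.Icc (0 : ℝ) 1
  b_adapted : ∀ t ∈ Finset.Icc 1 E.T, Measurable[ℱ t] (E.b t)
  b_indep : ∀ t < E.T, Indep (MeasurableSpace.comap (E.b (t + 1)) inferInstance) (ℱ t) P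

open Classical in
/-- Number `N_Θ` of distribution segments: one plus the number of rounds after which the reward
distribution of some base arm changes. -/
def numDistSegments : ℕ :=
  1 + ((Finset.Ico 1 E.T).filter fun t =>
    ∃ k, P.map (fun ω => E.b t ω k) ≠ P.map (fun ω => E.b (t + 1) ω k)).card

open Classical in
/-- Number `N_W` of graph segments. -/
def numGraphSegments : ℕ :=
  1 + ((Finset.Ico 1 E.T).filter fun t => E.W t ≠ E.W (t + 1)).card

/-- Payoff `r_t(x) = cᵀ y_t`. -/
def payoff (t : ℕ) (I : Finset (Fin K)) (ω : Ω) : ℝ :=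
  E.c ⬝ᵥ endoOutput (E.W t) (E.b t ω) I

/-- Expected payoff `ψ_t(x)`. -/
def expPayoff (t : ℕ) (I : Finset (Fin K)) : ℝ := ∫ ω, E.payoff t I ω ∂P

/-- `ψ_t(x_t^*)`. -/
def optPayoff (t : ℕ) : ℝ :=
  (feasible K E.m).sup' (feasible_nonempty K E.m) (E.expPayoff P t)

/-- The gaps of all suboptimal feasible super arms in all rounds. -/
def gaps : Set ℝ :=
  {d | ∃ t ∈ Finset.Icc 1 E.T, ∃ I ∈ feasible K E.m,
    E.expPayoff P t I < E.optPayoff P t ∧ d = E.optPayoff P t - E.expPayoff P t I}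

def gapMax : ℝ := sSup (E.gaps P)

def gapMin : ℝ := sInf (E.gaps P)

/-- Expected regret of the super arms `I 1, …, I T`. -/
def regret (I : ℕ → Ω → Finset (Fin K)) : ℝ :=
  ∫ ω, ∑ t ∈ Finset.Icc 1 E.T, (E.optPayoff P t - E.expPayoff P t (I t ω)) ∂P

end Bandit

/-! ## The algorithm -/

/-- Inputs of PS-SEM-UCB-Gr: forced-exploration parameter `p`, confidence level `δ` and threshold
function `γ` of the change-point detector, regularization `lam` and accepted error `eps` of the
graph estimation, grouping `G` of the base arms, columns `init` of the initialization matrix. -/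
structure Params (K : ℕ) where
  p : ℝ
  δ : ℝ
  γ : ℕ → ℝ → ℝ
  lam : ℝ
  eps : ℝ
  G : Finpartition (Finset.univ : Finset (Fin K))
  init : Fin K → Finset (Fin K)

/-- Memory of the algorithm between two rounds. -/
structure State (K : ℕ) where
  /-- observed rewards of each arm since its last restart -/
  samples : Fin K → List ℝ
  /-- last restart time of each arm -/
  tau : Fin K → ℕ
  /-- time of the last detection -/
  tauGlob : ℕ
  /-- UCB indices -/
  U : Fin K → ℝ
  /-- arms waiting for a forced play -/
  queue : Finset (Fin K)
  /-- number of columns of the initialization matrix played in the current graph learning phase;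
  the phase is running as long as it is below `K` -/
  col : ℕ
  /-- estimated adjacency matrix -/
  What : Matrix (Fin K) (Fin K) ℝ
  /-- the feedback `(y, z)` used for estimating the graph -/
  data : List ((Fin K → ℝ) × (Fin K → ℝ))

/-- The initial memory (the entries of `U` and `What` are placeholders). -/
def State.initial (K : ℕ) : State K where
  samples := fun _ => []
  tau := fun _ => 0
  tauGlob := 0
  U := 0
  queue := ∅
  col := 0
  What := 0
  data := []

/-- Number `n_k` of observations since the last restart. -/
def State.n {K : ℕ} (S : State K) (k : Fin K) : ℕ := (S.samples k).length

/-- Empirical mean since the last restart (`0` without observations). -/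
def State.muHat {K : ℕ} (S : State K) (k : Fin K) : ℝ := (S.samples k).sum / S.n k

/-- Binary relative entropy. With `Real.log 0 = 0` and `x / 0 = 0`, it has the usual conventions
at the arguments that the detector uses. -/
def kl (x y : ℝ) : ℝ := x * Real.log (x / y) + (1 - x) * Real.log ((1 - x) / (1 - y))

def mean (l : List ℝ) : ℝ := l.sum / l.length

/-- The generalized likelihood ratio test raises an alarm on the samples `s`. -/
def GLR (thr : ℝ) (s : List ℝ) : Prop :=
  ∃ α ∈ Finset.Ico 1 s.length,
    thr ≤ α * kl (mean (s.take α)) (mean s)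
      + ((s.length - α : ℕ) : ℝ) * kl (mean (s.drop α)) (mean s)

/-- Squared residual `‖y - V y - z‖₂²`. -/
def residual {K : ℕ} (V : Matrix (Fin K) (Fin K) ℝ) (y z : Fin K → ℝ) : ℝ :=
  ∑ k, (y k - (V *ᵥ y) k - z k) ^ 2

/-- `‖Y - V Y - Z‖_F² + lam ‖V‖₁`, the columns of `Y` and `Z` being the entries of `data`. -/
def graphLoss {K : ℕ} (lam : ℝ) (data : List ((Fin K → ℝ) × (Fin K → ℝ)))
    (V : Matrix (Fin K) (Fin K) ℝ) : ℝ :=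
  (data.map fun d => residual V d.1 d.2).sum + lam * ∑ i, ∑ j, |V i j|

/-- `V` solves the graph learning problem: it minimizes the loss among the matrices with zero
diagonal. -/
def IsGraphEstimate {K : ℕ} (lam : ℝ) (data : List ((Fin K → ℝ) × (Fin K → ℝ)))
    (V : Matrix (Fin K) (Fin K) ℝ) : Prop :=
  (∀ k, V k k = 0) ∧
    ∀ V' : Matrix (Fin K) (Fin K) ℝ, (∀ k, V' k k = 0) →
      graphLoss lam data V ≤ graphLoss lam data V'

section Algorithm

variable {K : ℕ} (A : Params K)

/-- The detector of arm `k` raises an alarm in a round with rewards `b` and super arm `I`. -/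
def Alarm (b : Fin K → ℝ) (I : Finset (Fin K)) (S : State K) (k : Fin K) : Prop :=
  k ∈ I ∧ GLR (A.γ (S.n k + 1) A.δ) (S.samples k ++ [exoInput b I k])

/-- The group of arm `k` is restarted in this round. -/
def Restarted (b : Fin K → ℝ) (I : Finset (Fin K)) (S : State K) (k : Fin K) : Prop :=
  ∃ j ∈ A.G.part k, Alarm A b I S j

/-- The next round is a forced play of an arm in the queue. -/
def Forced (S : State K) : Prop := K ≤ S.col ∧ S.queue.Nonempty

open Classical in
/-- The queue after round `t`, if it is `O` after the removal of the arm played by force: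
restarted groups are added, and in normal rounds all arms are put in at the multiples of `⌊K/p⌋`
since the last detection. -/
def nextQueue (t : ℕ) (b : Fin K → ℝ) (I : Finset (Fin K)) (S S' : State K)
    (O : Finset (Fin K)) : Finset (Fin K) :=
  if K ≤ S.col ∧ ∃ i : ℕ, 1 ≤ i ∧ t = S'.tauGlob + i * ⌊(K : ℝ) / A.p⌋₊ then Finset.univ
  else O ∪ Finset.univ.filter (Restarted A b I S)

/-- `I` maximizes `cᵀ (1 - What)⁻¹ diag(U) x` over the feasible decision vectors. -/
def IsGreedy (m : ℕ) (c : Fin K → ℝ) (S : State K) (I : Finset (Fin K)) : Prop :=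
  I ∈ feasible K m ∧ ∀ J ∈ feasible K m,
    c ⬝ᵥ ((1 - S.What)⁻¹ *ᵥ (Matrix.diagonal S.U *ᵥ vec J))
      ≤ c ⬝ᵥ ((1 - S.What)⁻¹ *ᵥ (Matrix.diagonal S.U *ᵥ vec I))

open Classical in
/-- Round `t` of PS-SEM-UCB-Gr in an environment with adjacency matrix `W` and rewards `b`:
the algorithm with memory `S` may play `I` and reach the memory `S'`. Ties in the maximization,
the arm picked from the queue, the super arm played by force and the choice among several
graph estimates are left free. -/
structure Step (m : ℕ) (c : Fin K → ℝ) (t : ℕ) (W : Matrix (Fin K) (Fin K) ℝ) (b : Fin K → ℝ)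
    (I : Finset (Fin K)) (S S' : State K) : Prop where
  play_init : ∀ h : S.col < K, I = A.init ⟨S.col, h⟩
  play_forced : Forced S → I ∈ feasible K m ∧
    ∃ a ∈ S.queue, a ∈ I ∧ S'.queue = nextQueue A t b I S S' (S.queue.erase a)
  play_greedy : K ≤ S.col → S.queue = ∅ → IsGreedy m c S I
  queue_eq : ¬ Forced S → S'.queue = nextQueue A t b I S S' S.queue
  samples_eq : ∀ k, S'.samples k =
    if Restarted A b I S k then []
    else if k ∈ I then S.samples k ++ [exoInput b I k] else S.samples k
  tau_eq : ∀ k, S'.tau k = if Restarted A b I S k then t else S.tau k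
  tauGlob_eq : S'.tauGlob = if ∃ k, Alarm A b I S k then t else S.tauGlob
  U_eq : ∀ k, S'.U k =
    if S'.n k ≠ 0 then
      S'.muHat k + √((m + 1 : ℝ) * Real.log ((t : ℝ) - S'.tau k) / S'.n k)
    else S.U k
  /-- In a graph learning round the feedback is stored; the graph is estimated after the last one. -/
  learn : S.col < K →
    S'.col = S.col + 1 ∧ S'.data = S.data ++ [(endoOutput W b I, exoInput b I)] ∧
      (S'.col = K → IsGraphEstimate A.lam S'.data S'.What) ∧
      (S'.col ≠ K → S'.What = S.What)
  /-- A normal round in which the feedback contradicts the estimated graph starts a new graph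
  learning phase. -/
  graph_change : K ≤ S.col → A.eps < residual S.What (endoOutput W b I) (exoInput b I) →
    S'.col = 0 ∧ S'.data = [] ∧ S'.What = S.What
  /-- Otherwise the estimate is updated with the new feedback. -/
  graph_update : K ≤ S.col → residual S.What (endoOutput W b I) (exoInput b I) ≤ A.eps →
    S'.col = S.col ∧ S'.data = S.data ++ [(endoOutput W b I, exoInput b I)] ∧
      IsGraphEstimate A.lam S'.data S'.What

variable {Ω : Type*} [MeasurableSpace Ω] (E : Bandit K Ω) (P : Measure Ω)

/-- A run of PS-SEM-UCB-Gr: `I t` is the super arm of round `t`, chosen on the basis of the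
information before round `t`, and `S t` is the memory after round `t`. -/
structure IsRun (ℱ : Filtration ℕ ‹MeasurableSpace Ω›)
    (I : ℕ → Ω → Finset (Fin K)) (S : ℕ → Ω → State K) : Prop where
  predictable : ∀ t < E.T, ∀ J, MeasurableSet[ℱ t] {ω | I (t + 1) ω = J}
  start : ∀ᵐ ω ∂P, S 0 ω = State.initial K
  step : ∀ᵐ ω ∂P, ∀ t < E.T,
    Step A E.m E.c (t + 1) (E.W (t + 1)) (E.b (t + 1) ω) (I (t + 1) ω) (S t ω) (S (t + 1) ω)

/-- The initialization matrix is admissible: its columns are feasible decision vectors, and they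
play every base arm at least once. -/
def InitAdmissible (m : ℕ) : Prop :=
  (∀ j, A.init j ∈ feasible K m) ∧ ∀ k, ∃ j, k ∈ A.init j

/-- The data of every completed graph learning phase identify the current graph: the graph learning
problem on these data has no other solution than the true adjacency matrix. -/
def GraphIdentified (S : ℕ → Ω → State K) : Prop :=
  ∀ᵐ ω ∂P, ∀ t < E.T, (S t ω).col + 1 = K →
    ∀ V, IsGraphEstimate A.lam (S (t + 1) ω).data V → V = E.W (t + 1)

/-- The event that some detector raises an alarm in the rounds `1, …, T`. -/
def alarmEvent (I : ℕ → Ω → Finset (Fin K)) (S : ℕ → Ω → State K) : Set Ω :=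
  {ω | ∃ t < E.T, ∃ k, Alarm A (E.b (t + 1) ω) (I (t + 1) ω) (S t ω) k}

/-- The event that round `t` is a forced play. -/
def forcedEvent (S : ℕ → Ω → State K) (t : ℕ) : Set Ω := {ω | Forced (S (t - 1) ω)}

/-- `ω_max`: the (essential) maximum, over the rounds `t` after the first graph learning phase
and over the arms `k`, of the entries of `cᵀ (1 - What_{t-1})⁻¹ diag(x_t)`. -/
def omegaMax (I : ℕ → Ω → Finset (Fin K)) (S : ℕ → Ω → State K) : ℝ :=
  essSup (fun ω => ⨆ t : Finset.Ioc K E.T, ⨆ k : Fin K,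
    ((E.c ᵥ* (1 - (S (t - 1) ω).What)⁻¹) ᵥ* Matrix.diagonal (vec (I t ω))) k) P

/-- `4 ω_max² m² (m+1) K log T / Δ_min² + (π²/3) m K + K`. -/
def stationaryBound (I : ℕ → Ω → Finset (Fin K)) (S : ℕ → Ω → State K) : ℝ :=
  4 * omegaMax E P I S ^ 2 * (E.m : ℝ) ^ 2 * (E.m + 1) * K * Real.log E.T / E.gapMin P ^ 2
    + Real.pi ^ 2 / 3 * E.m * K + K

end Algorithm

end SemBandit

end

/-! The payoff is linear in the rewards: `cᵀ (1 - W)⁻¹ diag(u) x` is the sum over the played arms of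
`weight c W k * u k`, and acyclicity with nonnegative entries makes every weight nonnegative. Depth
enters only through these weights, which is why the number of layers does not appear in the bound.

Stationarity makes the graph problem trivial after the first learning phase. The estimate is then
exactly `W` by identifiability, the residual of later feedback is zero, so no new phase starts, and
re-estimation keeps `W` as the only minimizer (`estimate_eq`). If moreover no alarm occurs, the
indices are UCB indices over the whole history (`index_eq`).

On such a trajectory a round with positive regret is an initialization round (at most `K`), a forced
play, a round in which some empirical mean leaves its confidence interval, or a greedy round with
accurate means. In the last case optimism bounds the gap by the weighted confidence widths, so a
played arm has few observations (`exists_playCount_le`); counting such rounds arm by arm gives the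
logarithmic term (`card_le_of_playCount_le`).

Deviations are controlled although the sample sizes are random: selection is predictable, so an
exponential supermartingale and a union over the sample size give a Hoeffding bound
(`measureReal_abs_selSum_le`), whose sum over rounds and arms is at most `π² / 3 * K`. On the alarm
event every round is charged the maximal gap. Integrating yields the general bound; the alarm-free
one is the case where both correction terms vanish. -/

namespace SemBandit

/-! ## Acyclic weighted graphs and linear payoffs -/

section Graph

variable {K : ℕ} {W : Matrix (Fin K) (Fin K) ℝ}

theorem one_sub_mulVec_apply (W : Matrix (Fin K) (Fin K) ℝ) (v : Fin K → ℝ) (i : Fin K) :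
    ((1 - W) *ᵥ v) i = v i - ∑ j, W i j * v j := by
  rw [Matrix.sub_mulVec, Matrix.one_mulVec]
  rfl

/-- A minimum principle: `v i` is the nonnegative `((1 - W) *ᵥ v) i` plus a nonnegative combination
of the values at the parents of `i`, so well-founded induction along the edges applies. -/
theorem IsDAG.nonneg_of_mulVec_nonneg (hW : IsDAG W) (h0 : ∀ i j, 0 ≤ W i j) {v : Fin K → ℝ}
    (hv : ∀ i, 0 ≤ ((1 - W) *ᵥ v) i) (i : Fin K) : 0 ≤ v i := by
  let r : Fin K → Fin K → Prop := Relation.TransGen (fun j i => W i j ≠ 0)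
  have : IsTrans (Fin K) r := ⟨fun _ _ _ => Relation.TransGen.trans⟩
  have : Std.Irrefl r := ⟨hW⟩
  induction i using (Finite.wellFounded_of_trans_of_irrefl r).induction with
  | _ i ih =>
    have h1 := hv i
    rw [one_sub_mulVec_apply] at h1
    have h2 : 0 ≤ ∑ j, W i j * v j := by
      refine Finset.sum_nonneg fun j _ => ?_
      by_cases h : W i j = 0
      · simp [h]
      · exact mul_nonneg (h0 i j) (ih j (Relation.TransGen.single h))
    linarith

theorem IsDAG.isUnit_det (hW : IsDAG W) (h0 : ∀ i j, 0 ≤ W i j) : IsUnit (1 - W).det := by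
  rw [← Matrix.isUnit_iff_isUnit_det, ← Matrix.mulVec_injective_iff_isUnit]
  -- A kernel vector and its negative both satisfy the minimum principle, so the vector is zero.
  refine (injective_iff_map_eq_zero (Matrix.mulVecLin (1 - W))).2 fun v hv => ?_
  rw [Matrix.mulVecLin_apply] at hv
  have h1 := hW.nonneg_of_mulVec_nonneg h0 (v := v) (by simp [hv])
  have h2 := hW.nonneg_of_mulVec_nonneg h0 (v := -v) (by simp [Matrix.mulVec_neg, hv])
  funext i
  have := h2 i
  simp only [Pi.neg_apply] at this
  have h3 := h1 i
  simp only [Pi.zero_apply]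
  linarith

theorem IsDAG.inv_nonneg (hW : IsDAG W) (h0 : ∀ i j, 0 ≤ W i j) (i j : Fin K) :
    0 ≤ (1 - W)⁻¹ i j := by
  -- The minimum principle for column `j` of the inverse, which `1 - W` maps to a basis vector.
  have h := hW.nonneg_of_mulVec_nonneg h0 (v := (1 - W)⁻¹ *ᵥ Pi.single j 1) ?_ i
  · simpa using h
  · intro k
    rw [Matrix.mulVec_mulVec, Matrix.mul_nonsing_inv _ (hW.isUnit_det h0), Matrix.one_mulVec]
    by_cases hk : k = j
    · subst hk; simp
    · simp [hk]

/-- The contribution `(cᵀ (1 - W)⁻¹)_k` of a unit input at node `k` to the payoff. -/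
noncomputable def weight (c : Fin K → ℝ) (W : Matrix (Fin K) (Fin K) ℝ) : Fin K → ℝ := c ᵥ* (1 - W)⁻¹

theorem weight_nonneg {c : Fin K → ℝ} (hc : ∀ k, 0 ≤ c k) (hW : IsDAG W)
    (h0 : ∀ i j, 0 ≤ W i j) (k : Fin K) : 0 ≤ weight c W k :=
  show 0 ≤ ∑ i, c i * (1 - W)⁻¹ i k from
    Finset.sum_nonneg fun i _ => mul_nonneg (hc i) (hW.inv_nonneg h0 i k)

theorem diagonal_mulVec_vec (u : Fin K → ℝ) (J : Finset (Fin K)) (k : Fin K) :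
    (Matrix.diagonal u *ᵥ vec J) k = if k ∈ J then u k else 0 := by
  simp [Matrix.mulVec_diagonal, vec]

theorem dotProduct_inv_mulVec (c u : Fin K → ℝ) (W : Matrix (Fin K) (Fin K) ℝ)
    (J : Finset (Fin K)) :
    c ⬝ᵥ ((1 - W)⁻¹ *ᵥ (Matrix.diagonal u *ᵥ vec J)) = ∑ k ∈ J, weight c W k * u k := by
  rw [Matrix.dotProduct_mulVec]
  simp only [dotProduct, diagonal_mulVec_vec, mul_ite, mul_zero]
  rw [← Finset.sum_filter]
  simp [weight]

theorem residual_endoOutput (hW : IsDAG W) (h0 : ∀ i j, 0 ≤ W i j) (b : Fin K → ℝ)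
    (J : Finset (Fin K)) : residual W (endoOutput W b J) (exoInput b J) = 0 := by
  have h : (1 - W) *ᵥ endoOutput W b J = exoInput b J := by
    rw [endoOutput, Matrix.mulVec_mulVec, Matrix.mul_nonsing_inv _ (hW.isUnit_det h0),
      Matrix.one_mulVec]
  refine Finset.sum_eq_zero fun k _ => ?_
  rw [← h]
  simp [Matrix.sub_mulVec]

/-- A unique graph estimate that reproduces the new feedback exactly remains the unique one. -/
theorem IsGraphEstimate.eq_of_append {lam : ℝ} {data : List ((Fin K → ℝ) × (Fin K → ℝ))}
    {y z : Fin K → ℝ} (hest : IsGraphEstimate lam data W) (hres : residual W y z = 0)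
    (huniq : ∀ V, IsGraphEstimate lam data V → V = W) {V : Matrix (Fin K) (Fin K) ℝ}
    (hV : IsGraphEstimate lam (data ++ [(y, z)]) V) : V = W := by
  have hloss : ∀ V, graphLoss lam (data ++ [(y, z)]) V = graphLoss lam data V + residual V y z := by
    intro V; simp only [graphLoss, List.map_append, List.sum_append, List.map_cons, List.map_nil,
      List.sum_cons, List.sum_nil]; ring
  -- The added residual is nonnegative and vanishes at `W`; hence a minimizer of the new loss has
  -- old loss at most that of `W` and was already a minimizer for the old data.
  refine huniq V ⟨hV.1, fun V' hV' => ?_⟩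
  have h1 := hV.2 W hest.1
  rw [hloss, hloss, hres] at h1
  have h2 : 0 ≤ residual V y z := Finset.sum_nonneg fun k _ => sq_nonneg _
  have h3 := hest.2 V' hV'
  linarith

end Graph

/-! ## Counting rounds -/

section Counting

/-- Number of the first `s` rounds in which arm `k` is played. -/
def playCount {K : ℕ} (I : ℕ → Finset (Fin K)) (k : Fin K) (s : ℕ) : ℕ :=
  ((Finset.range s).filter fun i => k ∈ I (i + 1)).card

/-- Sum of the rewards of arm `k` observed in the first `s` rounds. -/
noncomputable def playSum {K : ℕ} (I : ℕ → Finset (Fin K)) (b : ℕ → Fin K → ℝ) (k : Fin K) (s : ℕ) : ℝ :=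
  ∑ i ∈ Finset.range s, if k ∈ I (i + 1) then b (i + 1) k else 0

theorem playCount_succ {K : ℕ} (I : ℕ → Finset (Fin K)) (k : Fin K) (s : ℕ) :
    playCount I k (s + 1) = playCount I k s + if k ∈ I (s + 1) then 1 else 0 := by
  unfold playCount
  rw [Finset.range_add_one, Finset.filter_insert]
  split_ifs <;> simp

theorem playCount_mono {K : ℕ} (I : ℕ → Finset (Fin K)) (k : Fin K) : Monotone (playCount I k) :=
  monotone_nat_of_le_succ fun s => by rw [playCount_succ]; omega

/-- If in each round of `G` some arm is played that had been played at most `L` times, then `G`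
has at most `K L` rounds, provided that each arm was played before. -/
theorem card_le_of_playCount_le {K : ℕ} (I : ℕ → Finset (Fin K)) (t₀ : ℕ) (G : Finset ℕ)
    (hG : ∀ t ∈ G, t₀ ≤ t) (h0 : ∀ k, 1 ≤ playCount I k t₀) {L : ℝ} (hL : 0 ≤ L)
    (h : ∀ t ∈ G, ∃ k ∈ I (t + 1), (playCount I k t : ℝ) ≤ L) : (G.card : ℝ) ≤ K * L := by
  classical
  have key : ∀ k, ((G.filter fun t => k ∈ I (t + 1) ∧ (playCount I k t : ℝ) ≤ L).card : ℝ) ≤ L := by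
    intro k
    set F := G.filter fun t => k ∈ I (t + 1) ∧ (playCount I k t : ℝ) ≤ L with hF
    rcases F.eq_empty_or_nonempty with he | hne
    · simpa [he] using hL
    · have hmem := F.max'_mem hne
      set t := F.max' hne with ht
      have hmem' := hmem
      rw [hF, Finset.mem_filter] at hmem'
      refine le_trans ?_ hmem'.2.2
      -- Before the last round `t` of `F`, arm `k` was played in all other rounds of `F` and at
      -- least once before `t₀`. The early play compensates for the erased round, so the bound is
      -- `L` and not `L + 1`.
      have hsub : (F.erase t) ∪ ((Finset.range t₀).filter fun i => k ∈ I (i + 1)) ⊆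
          (Finset.range t).filter fun i => k ∈ I (i + 1) := by
        intro s hs
        rw [Finset.mem_union, Finset.mem_erase, Finset.mem_filter (s := Finset.range t₀),
          Finset.mem_range] at hs
        rw [Finset.mem_filter, Finset.mem_range]
        rcases hs with ⟨h1, h2⟩ | ⟨h1, h2⟩
        · exact ⟨lt_of_le_of_ne (F.le_max' s h2) h1, (Finset.mem_filter.1 h2).2.1⟩
        · exact ⟨lt_of_lt_of_le h1 (hG t hmem'.1), h2⟩
      have hdisj : Disjoint (F.erase t) ((Finset.range t₀).filter fun i => k ∈ I (i + 1)) := by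
        rw [Finset.disjoint_left]
        intro s h1 h2
        have h3 := hG s (Finset.mem_filter.1 (Finset.mem_of_mem_erase h1)).1
        have h4 := Finset.mem_range.1 (Finset.mem_filter.1 h2).1
        omega
      have hc := Finset.card_le_card hsub
      rw [Finset.card_union_of_disjoint hdisj, Finset.card_erase_of_mem hmem] at hc
      have h1 := h0 k
      have h2 := Finset.card_pos.2 hne
      unfold playCount at h1 ⊢
      exact_mod_cast (by omega :
        F.card ≤ ((Finset.range t).filter fun i => k ∈ I (i + 1)).card)
  have hcov : G ⊆ Finset.univ.biUnion fun k =>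
      G.filter fun t => k ∈ I (t + 1) ∧ (playCount I k t : ℝ) ≤ L := by
    intro t ht
    obtain ⟨k, hk, hk'⟩ := h t ht
    exact Finset.mem_biUnion.2 ⟨k, Finset.mem_univ k, Finset.mem_filter.2 ⟨ht, hk, hk'⟩⟩
  calc (G.card : ℝ) ≤ ((Finset.univ.biUnion fun k =>
          G.filter fun t => k ∈ I (t + 1) ∧ (playCount I k t : ℝ) ≤ L).card : ℝ) := by
        exact_mod_cast Finset.card_le_card hcov
    _ ≤ ∑ k : Fin K, ((G.filter fun t => k ∈ I (t + 1) ∧ (playCount I k t : ℝ) ≤ L).card : ℝ) := by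
        exact_mod_cast Finset.card_biUnion_le
    _ ≤ ∑ _k : Fin K, L := Finset.sum_le_sum fun k _ => key k
    _ = K * L := by simp

/-- Comparison of the greedy super arm with another one, if the indices overestimate the means by
at most `2 C`. -/
theorem sub_le_of_greedy {ι : Type*} {w μ U C : ι → ℝ} {J J' : Finset ι} (hw : ∀ k, 0 ≤ w k)
    (hlow : ∀ k ∈ J', μ k ≤ U k) (hup : ∀ k ∈ J, U k ≤ μ k + 2 * C k)
    (hgreedy : ∑ k ∈ J', w k * U k ≤ ∑ k ∈ J, w k * U k) :
    ∑ k ∈ J', w k * μ k - ∑ k ∈ J, w k * μ k ≤ ∑ k ∈ J, w k * (2 * C k) := by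
  have h1 : ∑ k ∈ J', w k * μ k ≤ ∑ k ∈ J', w k * U k :=
    Finset.sum_le_sum fun k hk => mul_le_mul_of_nonneg_left (hlow k hk) (hw k)
  have h2 : ∑ k ∈ J, w k * U k ≤ ∑ k ∈ J, w k * μ k + ∑ k ∈ J, w k * (2 * C k) := by
    rw [← Finset.sum_add_distrib]
    refine Finset.sum_le_sum fun k hk => ?_
    rw [← mul_add]
    exact mul_le_mul_of_nonneg_left (hup k hk) (hw k)
  linarith

/-- A gap `d` bounded by the confidence widths forces one of the arms to have few observations. -/
theorem exists_le_of_le_sum {ι : Type*} {w N : ι → ℝ} {J : Finset ι} {m : ℕ} {d om v v' : ℝ}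
    (hd : 0 < d) (hJ : J.card ≤ m) (hw : ∀ k ∈ J, w k ≤ om) (hw0 : ∀ k, 0 ≤ w k) (hv : v ≤ v')
    (hv0 : 0 ≤ v)
    (h : d ≤ ∑ k ∈ J, w k * (2 * √(v / N k))) :
    ∃ k ∈ J, N k ≤ 4 * om ^ 2 * m ^ 2 * v' / d ^ 2 := by
  by_contra! hcon
  have hne : J.Nonempty := by
    rw [Finset.nonempty_iff_ne_empty]
    rintro rfl
    simp at h; linarith
  have hm : 0 < (m : ℝ) := by
    have := Finset.card_pos.2 hne
    exact_mod_cast (by omega : 0 < m)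
  have hom : 0 ≤ om := by
    obtain ⟨k, hk⟩ := hne
    exact (hw0 k).trans (hw k hk)
  -- If every count exceeded the threshold, each summand would be below `d / m`, and at most `m`
  -- summands could not reach `d`.
  have hlt : ∀ k ∈ J, w k * (2 * √(v / N k)) < d / m := by
    intro k hk
    have hN := hcon k hk
    have hN0 : 0 < N k := lt_of_le_of_lt (by have := hv0.trans hv; positivity) hN
    have h1 : w k * (2 * √(v / N k)) ≤ om * (2 * √(v / N k)) :=
      mul_le_mul_of_nonneg_right (hw k hk) (by positivity)
    refine lt_of_le_of_lt h1 (lt_of_pow_lt_pow_left₀ 2 (by positivity) ?_)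
    rw [mul_pow, mul_pow, Real.sq_sqrt (by positivity), div_pow]
    rw [div_lt_iff₀ (by positivity)] at hN
    rw [lt_div_iff₀ (by positivity), show om ^ 2 * (2 ^ 2 * (v / N k)) * (m : ℝ) ^ 2
      = 4 * om ^ 2 * m ^ 2 * v / N k by ring, div_lt_iff₀ hN0]
    have : 4 * om ^ 2 * (m : ℝ) ^ 2 * v ≤ 4 * om ^ 2 * m ^ 2 * v' :=
      mul_le_mul_of_nonneg_left hv (by positivity)
    nlinarith
  have h2 : ∑ k ∈ J, w k * (2 * √(v / N k)) < ∑ _k ∈ J, d / m := Finset.sum_lt_sum_of_nonempty hne hlt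
  rw [Finset.sum_const, nsmul_eq_mul] at h2
  have h3 : (J.card : ℝ) * (d / m) ≤ m * (d / m) :=
    mul_le_mul_of_nonneg_right (by exact_mod_cast hJ) (by positivity)
  rw [mul_div_cancel₀ _ hm.ne'] at h3
  linarith

end Counting

/-! ## Deviations of predictably sampled sums -/

section Deviation

/-- Number of selected rounds among the first `s`. -/
noncomputable def selCount {Ω : Type*} (D : ℕ → Set Ω) (s : ℕ) (ω : Ω) : ℝ :=
  ∑ i ∈ Finset.range s, (D (i + 1)).indicator (fun _ => (1 : ℝ)) ω

/-- Sum of the values of the selected rounds among the first `s`. -/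
noncomputable def selSum {Ω : Type*} (Y : ℕ → Ω → ℝ) (D : ℕ → Set Ω) (s : ℕ) (ω : Ω) : ℝ :=
  ∑ i ∈ Finset.range s, (D (i + 1)).indicator (Y (i + 1)) ω

theorem selCount_eq_card {Ω : Type*} (D : ℕ → Set Ω) (s : ℕ) (ω : Ω) [DecidablePred fun i => ω ∈ D (i + 1)] :
    selCount D s ω = ((Finset.range s).filter fun i => ω ∈ D (i + 1)).card := by
  rw [Finset.card_filter]
  push_cast
  exact Finset.sum_congr rfl fun i _ => by simp [Set.indicator_apply]

variable {Ω : Type*} [mΩ : MeasurableSpace Ω] {P : Measure Ω} [IsProbabilityMeasure P]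
  {ℱ : Filtration ℕ mΩ} {T : ℕ} {Y : ℕ → Ω → ℝ} {D : ℕ → Set Ω}

theorem measurable_selCount (hD : ∀ t < T, MeasurableSet[ℱ t] (D (t + 1))) {s : ℕ} (hs : s ≤ T) :
    Measurable[ℱ s] (selCount D s) := by
  refine Finset.measurable_fun_sum _ fun i hi => ?_
  have hi' := Finset.mem_range.1 hi
  exact measurable_const.indicator (ℱ.mono hi'.le _ (hD i (by omega)))

theorem measurable_selSum (hY : ∀ t ∈ Finset.Icc 1 T, Measurable[ℱ t] (Y t))
    (hD : ∀ t < T, MeasurableSet[ℱ t] (D (t + 1))) {s : ℕ} (hs : s ≤ T) :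
    Measurable[ℱ s] (selSum Y D s) := by
  refine Finset.measurable_fun_sum _ fun i hi => ?_
  have hi' := Finset.mem_range.1 hi
  exact ((hY (i + 1) (Finset.mem_Icc.2 ⟨by omega, by omega⟩)).mono
    (ℱ.mono (by omega : i + 1 ≤ s)) le_rfl).indicator (ℱ.mono hi'.le _ (hD i (by omega)))

/-- The supermartingale argument: an unselected round leaves the exponential unchanged, and a
selected one multiplies it by a factor independent of the past with mean at most one. The
compensator `l ^ 2 / 8` is the sub-Gaussian exponent for variance proxy `1 / 4`. -/
theorem lintegral_exp_sel_le_one (hY : ∀ t ∈ Finset.Icc 1 T, Measurable[ℱ t] (Y t))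
    (hind : ∀ t < T, Indep (MeasurableSpace.comap (Y (t + 1)) inferInstance) (ℱ t) P)
    (hsub : ∀ t ∈ Finset.Icc 1 T, HasSubgaussianMGF (Y t) (1 / 4) P)
    (hD : ∀ t < T, MeasurableSet[ℱ t] (D (t + 1))) (l : ℝ) {s : ℕ} (hs : s ≤ T) :
    ∫⁻ ω, ENNReal.ofReal (Real.exp (l * selSum Y D s ω - l ^ 2 / 8 * selCount D s ω)) ∂P ≤ 1 := by
  induction s with
  | zero => simp [selSum, selCount]
  | succ s ih =>
    have hs' : s < T := hs
    have hmem : s + 1 ∈ Finset.Icc 1 T := Finset.mem_Icc.2 ⟨by omega, by omega⟩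
    set Z : Ω → ENNReal := fun ω =>
      ENNReal.ofReal (Real.exp (l * selSum Y D s ω - l ^ 2 / 8 * selCount D s ω)) with hZ
    set g : Ω → ENNReal := fun ω => ENNReal.ofReal (Real.exp (l * Y (s + 1) ω - l ^ 2 / 8)) with hg
    have hZm : Measurable[ℱ s] Z := by
      refine ENNReal.measurable_ofReal.comp (Real.measurable_exp.comp ?_)
      exact (measurable_const.mul (measurable_selSum hY hD hs'.le)).sub
        (measurable_const.mul (measurable_selCount hD hs'.le))
    have hgm : Measurable[MeasurableSpace.comap (Y (s + 1)) inferInstance] g := by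
      have h1 : Measurable fun x : ℝ => ENNReal.ofReal (Real.exp (l * x - l ^ 2 / 8)) := by fun_prop
      exact h1.comp (comap_measurable (Y (s + 1)))
    have hg1 : ∫⁻ ω, g ω ∂P ≤ 1 := by
      have hi := (hsub _ hmem).integrable_exp_mul l
      have hm := (hsub _ hmem).mgf_le l
      have h2 : ∀ ω, Real.exp (l * Y (s + 1) ω - l ^ 2 / 8)
          = Real.exp (-(l ^ 2 / 8)) * Real.exp (l * Y (s + 1) ω) := by
        intro ω; rw [← Real.exp_add]; ring_nf
      simp only [hg, h2]
      rw [← ofReal_integral_eq_lintegral_ofReal (hi.const_mul _)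
        (Filter.Eventually.of_forall fun ω => by positivity), integral_const_mul]
      rw [ENNReal.ofReal_le_one]
      calc Real.exp (-(l ^ 2 / 8)) * ∫ ω, Real.exp (l * Y (s + 1) ω) ∂P
          ≤ Real.exp (-(l ^ 2 / 8)) * Real.exp (((1 / 4 : NNReal) : ℝ) * l ^ 2 / 2) :=
            mul_le_mul_of_nonneg_left hm (Real.exp_pos _).le
        _ = 1 := by
            rw [← Real.exp_add]
            have : -(l ^ 2 / 8) + ((1 / 4 : NNReal) : ℝ) * l ^ 2 / 2 = 0 := by
              push_cast; ring
            rw [this, Real.exp_zero]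
    have hDs : MeasurableSet (D (s + 1)) := ℱ.le s _ (hD s hs')
    have hZm' : Measurable Z := hZm.mono (ℱ.le s) le_rfl
    have hsplit : ∀ ω, ENNReal.ofReal (Real.exp
        (l * selSum Y D (s + 1) ω - l ^ 2 / 8 * selCount D (s + 1) ω))
        = (D (s + 1))ᶜ.indicator Z ω + (D (s + 1)).indicator Z ω * g ω := by
      intro ω
      by_cases h : ω ∈ D (s + 1)
      · simp only [selSum, selCount, Finset.sum_range_succ, h, Set.indicator_of_mem,
          Set.mem_compl_iff, not_true_eq_false, not_false_eq_true, Set.indicator_of_notMem,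
          zero_add, hZ, hg]
        rw [← ENNReal.ofReal_mul (Real.exp_pos _).le, ← Real.exp_add]
        ring_nf
      · simp [selSum, selCount, Finset.sum_range_succ, h, hZ]
    simp only [hsplit]
    rw [lintegral_add_left (hZm'.indicator hDs.compl)]
    -- Predictability is used here: `D (s + 1)` is already known at time `s`, so the indicator stays
    -- on the past side of the product.
    have hmul := lintegral_mul_eq_lintegral_mul_lintegral_of_independent_measurableSpace
      (ℱ.le s) (((hY _ hmem).mono (ℱ.le _) le_rfl).comap_le) (hind s hs').symm
      (hZm.indicator (hD s hs')) hgm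
    rw [hmul]
    calc ∫⁻ ω, (D (s + 1))ᶜ.indicator Z ω ∂P + (∫⁻ ω, (D (s + 1)).indicator Z ω ∂P) * ∫⁻ ω, g ω ∂P
        ≤ ∫⁻ ω, (D (s + 1))ᶜ.indicator Z ω ∂P + (∫⁻ ω, (D (s + 1)).indicator Z ω ∂P) * 1 := by
          gcongr
      _ = ∫⁻ ω, Z ω ∂P := by
          rw [mul_one, lintegral_indicator hDs.compl, lintegral_indicator hDs, add_comm,
            lintegral_add_compl _ hDs]
      _ ≤ 1 := ih hs'.le

/-- The Chernoff parameter must be tuned to the number of samples, which is random; a union over its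
possible values costs the factor `s`. -/
theorem measure_selSum_ge_le (hY : ∀ t ∈ Finset.Icc 1 T, Measurable[ℱ t] (Y t))
    (hind : ∀ t < T, Indep (MeasurableSpace.comap (Y (t + 1)) inferInstance) (ℱ t) P)
    (hsub : ∀ t ∈ Finset.Icc 1 T, HasSubgaussianMGF (Y t) (1 / 4) P)
    (hD : ∀ t < T, MeasurableSet[ℱ t] (D (t + 1))) {v : ℝ} (hv : 0 ≤ v) {s : ℕ} (hs : s ≤ T) :
    P {ω | 0 < selCount D s ω ∧ √(v / selCount D s ω) < selSum Y D s ω / selCount D s ω}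
      ≤ s * ENNReal.ofReal (Real.exp (-2 * v)) := by
  classical
  have hpeel : ∀ n ∈ Finset.Icc 1 s, P {ω | selCount D s ω = n ∧ √(v / n) < selSum Y D s ω / n}
      ≤ ENNReal.ofReal (Real.exp (-2 * v)) := by
    intro n hn
    have hn0 : (0 : ℝ) < n := by exact_mod_cast (Finset.mem_Icc.1 hn).1
    -- The maximizer of `l * √(v / n) * n - l ^ 2 / 8 * n`, with maximum `2 * v`.
    set l : ℝ := 4 * √(v / n) with hl
    have hl0 : 0 ≤ l := by positivity
    have hle := lintegral_exp_sel_le_one (P := P) hY hind hsub hD l hs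
    have hmeas : Measurable fun ω => ENNReal.ofReal
        (Real.exp (l * selSum Y D s ω - l ^ 2 / 8 * selCount D s ω)) := by
      have h1 := (measurable_selSum hY hD hs).mono (ℱ.le s) le_rfl
      have h2 := (measurable_selCount hD hs).mono (ℱ.le s) le_rfl
      fun_prop
    have hmk := mul_meas_ge_le_lintegral (μ := P) hmeas (ENNReal.ofReal (Real.exp (2 * v)))
    have hsubset : {ω | selCount D s ω = n ∧ √(v / n) < selSum Y D s ω / n} ⊆
        {ω | ENNReal.ofReal (Real.exp (2 * v)) ≤ ENNReal.ofReal
          (Real.exp (l * selSum Y D s ω - l ^ 2 / 8 * selCount D s ω))} := by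
      rintro ω ⟨h1, h2⟩
      refine ENNReal.ofReal_le_ofReal (Real.exp_le_exp.2 ?_)
      rw [lt_div_iff₀ hn0] at h2
      have h3 : √(v / n) ^ 2 = v / n := Real.sq_sqrt (by positivity)
      have h4 : l * (√(v / n) * n) ≤ l * selSum Y D s ω := mul_le_mul_of_nonneg_left h2.le hl0
      have h5 : l * (√(v / n) * n) = 4 * v := by
        rw [hl, show 4 * √(v / n) * (√(v / n) * n) = 4 * (√(v / n) ^ 2 * n) by ring, h3]
        field_simp
      have h6 : l ^ 2 / 8 * n = 2 * v := by
        rw [hl, mul_pow, h3]; field_simp; ring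
      rw [h1]; linarith
    have hexp : ENNReal.ofReal (Real.exp (-2 * v)) * ENNReal.ofReal (Real.exp (2 * v)) = 1 := by
      rw [← ENNReal.ofReal_mul (Real.exp_pos _).le, ← Real.exp_add]; simp
    calc P {ω | selCount D s ω = n ∧ √(v / n) < selSum Y D s ω / n}
        ≤ P _ := measure_mono hsubset
      _ = ENNReal.ofReal (Real.exp (-2 * v)) * (ENNReal.ofReal (Real.exp (2 * v)) * P _) := by
          rw [← mul_assoc, hexp, one_mul]
      _ ≤ ENNReal.ofReal (Real.exp (-2 * v)) * 1 := by gcongr; exact hmk.trans hle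
      _ = _ := mul_one _
  have hcov : {ω | 0 < selCount D s ω ∧ √(v / selCount D s ω) < selSum Y D s ω / selCount D s ω} ⊆
      ⋃ n ∈ Finset.Icc 1 s, {ω | selCount D s ω = n ∧ √(v / n) < selSum Y D s ω / n} := by
    rintro ω ⟨h1, h2⟩
    rw [selCount_eq_card] at h1 h2
    simp only [Set.mem_iUnion]
    refine ⟨_, Finset.mem_Icc.2 ⟨?_, ?_⟩, selCount_eq_card D s ω, h2⟩
    · exact_mod_cast h1
    · simpa using Finset.card_filter_le (Finset.range s) fun i => ω ∈ D (i + 1)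
  calc _ ≤ P (⋃ n ∈ Finset.Icc 1 s, {ω | selCount D s ω = n ∧ √(v / n) < selSum Y D s ω / n}) :=
        measure_mono hcov
    _ ≤ ∑ n ∈ Finset.Icc 1 s, P {ω | selCount D s ω = n ∧ √(v / n) < selSum Y D s ω / n} :=
        measure_biUnion_finset_le _ _
    _ ≤ ∑ _n ∈ Finset.Icc 1 s, ENNReal.ofReal (Real.exp (-2 * v)) := Finset.sum_le_sum hpeel
    _ = _ := by simp

theorem measureReal_abs_selSum_le (hY : ∀ t ∈ Finset.Icc 1 T, Measurable[ℱ t] (Y t))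
    (hind : ∀ t < T, Indep (MeasurableSpace.comap (Y (t + 1)) inferInstance) (ℱ t) P)
    (hsub : ∀ t ∈ Finset.Icc 1 T, HasSubgaussianMGF (Y t) (1 / 4) P)
    (hD : ∀ t < T, MeasurableSet[ℱ t] (D (t + 1))) {v : ℝ} (hv : 0 ≤ v) {s : ℕ} (hs : s ≤ T) :
    P.real {ω | 0 < selCount D s ω ∧ √(v / selCount D s ω) < |selSum Y D s ω / selCount D s ω|}
      ≤ 2 * s * Real.exp (-2 * v) := by
  have h1 := measure_selSum_ge_le hY hind hsub hD hv hs
  have h2 := measure_selSum_ge_le (Y := fun t ω => -Y t ω) (fun t ht => (hY t ht).neg)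
    (fun t ht => ?_) (fun t ht => (hsub t ht).neg) hD hv hs
  · have hneg : ∀ ω, selSum (fun t ω => -Y t ω) D s ω = -selSum Y D s ω := by
      intro ω
      rw [selSum, selSum, ← Finset.sum_neg_distrib]
      exact Finset.sum_congr rfl fun i _ => by
        by_cases h : ω ∈ D (i + 1) <;> simp [h]
    simp only [hneg] at h2
    refine ENNReal.toReal_le_of_le_ofReal (by positivity) ?_
    calc _ ≤ P ({ω | 0 < selCount D s ω ∧ √(v / selCount D s ω)
              < selSum Y D s ω / selCount D s ω} ∪
            {ω | 0 < selCount D s ω ∧ √(v / selCount D s ω)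
              < -selSum Y D s ω / selCount D s ω}) := by
          refine measure_mono ?_
          rintro ω ⟨h, h'⟩
          rcases lt_abs.1 h' with h' | h'
          · exact Or.inl ⟨h, h'⟩
          · exact Or.inr ⟨h, by rwa [neg_div]⟩
      _ ≤ _ := measure_union_le _ _
      _ ≤ _ := add_le_add h1 h2
      _ = _ := by
          rw [mul_assoc 2, ENNReal.ofReal_mul (by norm_num), ENNReal.ofReal_mul (by positivity)]
          simp [two_mul]
  · refine indep_of_indep_of_le_left (hind t ht) ?_
    exact ((comap_measurable (Y (t + 1))).neg).comap_le

end Deviation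

/-! ## Trajectories of the algorithm in a stationary environment -/

section Trajectory

variable {K : ℕ} {A : Params K} {m T : ℕ} {c : Fin K → ℝ} {W : Matrix (Fin K) (Fin K) ℝ}
  {b : ℕ → Fin K → ℝ} {I : ℕ → Finset (Fin K)} {S : ℕ → State K}

theorem exoInput_apply_of_mem {b : Fin K → ℝ} {J : Finset (Fin K)} {k : Fin K} (hk : k ∈ J) :
    exoInput b J k = b k := by
  rw [exoInput, diagonal_mulVec_vec, if_pos hk]

theorem Step.mem_feasible {t : ℕ} {b : Fin K → ℝ} {J : Finset (Fin K)} {S S' : State K}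
    (h : Step A m c t W b J S S') (hinit : InitAdmissible A m) : J ∈ feasible K m := by
  by_cases hcol : S.col < K
  · rw [h.play_init hcol]
    exact hinit.1 _
  · by_cases hq : S.queue = ∅
    · exact (h.play_greedy (not_lt.1 hcol) hq).1
    · exact (h.play_forced ⟨not_lt.1 hcol, Finset.nonempty_iff_ne_empty.2 hq⟩).1

variable (hstart : S 0 = State.initial K)
  (hstep : ∀ t < T, Step A m c (t + 1) W (b (t + 1)) (I (t + 1)) (S t) (S (t + 1)))
include hstart hstep

theorem col_eq_of_le {t : ℕ} (hT : t ≤ T) (hK : t ≤ K) : (S t).col = t := by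
  induction t with
  | zero => simp [hstart, State.initial]
  | succ t ih =>
    have h := ih (by omega) (by omega)
    rw [((hstep t (by omega)).learn (by omega)).1, h]

/-- After the first graph learning phase the estimate is and remains the true matrix. -/
theorem estimate_eq (hK : 0 < K) (hW : IsDAG W) (h0 : ∀ i j, 0 ≤ W i j) (heps : 0 ≤ A.eps)
    (hid : ∀ t < T, (S t).col + 1 = K → ∀ V, IsGraphEstimate A.lam (S (t + 1)).data V → V = W)
    {t : ℕ} (ht : K ≤ t) (hT : t ≤ T) :
    (S t).col = K ∧ (S t).What = W ∧ IsGraphEstimate A.lam (S t).data W ∧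
      ∀ V, IsGraphEstimate A.lam (S t).data V → V = W := by
  induction t, ht using Nat.le_induction with
  | base =>
    obtain ⟨t, rfl⟩ : ∃ t, K = t + 1 := ⟨K - 1, by omega⟩
    have hcol := col_eq_of_le hstart hstep (t := t) (by omega) (by omega)
    have hcol' := col_eq_of_le hstart hstep hT le_rfl
    have huniq := hid t (by omega) (by omega)
    have hest := ((hstep t (by omega)).learn (by omega)).2.2.1 hcol'
    have hWhat := huniq _ hest
    exact ⟨hcol', hWhat, hWhat ▸ hest, huniq⟩
  | succ t ht ih =>
    obtain ⟨hcol, hWhat, hest, huniq⟩ := ih (by omega)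
    have hres := residual_endoOutput hW h0 (b (t + 1)) (I (t + 1))
    -- The residual is zero and `eps` is nonnegative, so no graph change is declared.
    obtain ⟨h1, h2, h3⟩ := (hstep t (by omega)).graph_update hcol.ge (by rwa [hWhat, hres])
    rw [h2] at h3 ⊢
    have huniq' := fun V (hV : IsGraphEstimate A.lam _ V) => hest.eq_of_append hres huniq hV
    have hWhat' := huniq' _ h3
    exact ⟨h1.trans hcol, hWhat', hWhat' ▸ h3, huniq'⟩

/-- In the first phase `col` equals the number of elapsed rounds, so column `j` is played in round
`j + 1`. -/
theorem one_le_playCount (hinit : InitAdmissible A m) (hT : K ≤ T) (k : Fin K) :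
    1 ≤ playCount I k K := by
  obtain ⟨j, hj⟩ := hinit.2 k
  have hcol := col_eq_of_le hstart hstep (t := j) (by omega) (by omega)
  have hI := (hstep j (by omega)).play_init (by omega)
  refine Finset.card_pos.2 ⟨j, Finset.mem_filter.2 ⟨Finset.mem_range.2 j.2, ?_⟩⟩
  rw [hI]
  simpa only [hcol] using hj

/-- Without alarms, the statistics are those of the whole history. -/
theorem statistics_eq
    (hal : ∀ t < T, ∀ k, ¬ Alarm A (b (t + 1)) (I (t + 1)) (S t) k) {t : ℕ} (hT : t ≤ T)
    (k : Fin K) : (S t).tau k = 0 ∧ (S t).n k = playCount I k t ∧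
      ((S t).samples k).sum = playSum I b k t := by
  induction t with
  | zero => simp [hstart, State.initial, State.n, playCount, playSum]
  | succ t ih =>
    obtain ⟨h1, h2, h3⟩ := ih (by omega)
    have hr : ¬ Restarted A (b (t + 1)) (I (t + 1)) (S t) k :=
      fun ⟨j, _, hj⟩ => hal t (by omega) j hj
    have hs := (hstep t (by omega)).samples_eq k
    have ht := (hstep t (by omega)).tau_eq k
    rw [if_neg hr] at hs ht
    rw [State.n] at h2
    rw [State.n, playCount_succ, playSum, Finset.sum_range_succ, ← playSum, ht, hs, ← h2, ← h3]
    refine ⟨h1, ?_⟩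
    split_ifs with hk
    · simp [exoInput_apply_of_mem hk]
    · simp

theorem index_eq (hal : ∀ t < T, ∀ k, ¬ Alarm A (b (t + 1)) (I (t + 1)) (S t) k) {t : ℕ}
    (ht : 1 ≤ t) (hT : t ≤ T) {k : Fin K} (hk : 1 ≤ playCount I k t) :
    (S t).U k = playSum I b k t / playCount I k t
      + √((m + 1 : ℝ) * Real.log t / playCount I k t) := by
  obtain ⟨h1, h2, h3⟩ := statistics_eq hstart hstep hal hT k
  obtain ⟨s, rfl⟩ : ∃ s, t = s + 1 := ⟨t - 1, by omega⟩
  have hU := (hstep s (by omega)).U_eq k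
  rw [if_pos (by omega)] at hU
  rw [hU, State.muHat, h1, h2, h3]
  simp

/-- In a greedy round with a suboptimal super arm and accurate empirical means, some arm that is
played has few observations. -/
theorem exists_playCount_le {μ : Fin K → ℝ} {om d : ℝ} {J : Finset (Fin K)}
    (hK : 0 < K) (hW : IsDAG W) (h0 : ∀ i j, 0 ≤ W i j) (heps : 0 ≤ A.eps) (hc : ∀ k, 0 ≤ c k)
    (hinit : InitAdmissible A m)
    (hid : ∀ t < T, (S t).col + 1 = K → ∀ V, IsGraphEstimate A.lam (S (t + 1)).data V → V = W)
    (hal : ∀ t < T, ∀ k, ¬ Alarm A (b (t + 1)) (I (t + 1)) (S t) k)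
    {t : ℕ} (ht : K ≤ t) (hT : t < T) (hforced : ¬ Forced (S t))
    (hdev : ∀ k, |playSum I b k t / playCount I k t - μ k|
      ≤ √((m + 1 : ℝ) * Real.log t / playCount I k t))
    (hom : ∀ k ∈ I (t + 1), weight c W k ≤ om) (hJ : J ∈ feasible K m) (hd : 0 < d)
    (hgap : d ≤ ∑ k ∈ J, weight c W k * μ k - ∑ k ∈ I (t + 1), weight c W k * μ k) :
    ∃ k ∈ I (t + 1), (playCount I k t : ℝ)
      ≤ 4 * om ^ 2 * m ^ 2 * ((m + 1) * Real.log T) / d ^ 2 := by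
  obtain ⟨hcol, hWhat, -, -⟩ := estimate_eq hstart hstep hK hW h0 heps hid ht hT.le
  have hw := weight_nonneg hc hW h0
  have hq : (S t).queue = ∅ := by
    by_contra hq
    exact hforced ⟨hcol.ge, Finset.nonempty_iff_ne_empty.2 hq⟩
  have hgreedy := (hstep t hT).play_greedy hcol.ge hq
  have hcmp := hgreedy.2 J hJ
  rw [dotProduct_inv_mulVec, dotProduct_inv_mulVec, hWhat] at hcmp
  have hcount : ∀ k, 1 ≤ playCount I k t := fun k =>
    (one_le_playCount hstart hstep hinit (by omega) k).trans (playCount_mono I k ht)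
  have hU : ∀ k, (S t).U k = playSum I b k t / playCount I k t
      + √((m + 1 : ℝ) * Real.log t / playCount I k t) := fun k =>
    index_eq hstart hstep hal (by omega) hT.le (hcount k)
  -- A mean within `C k` of the truth puts the index between `μ k` and `μ k + 2 * C k`.
  have hle := sub_le_of_greedy (μ := μ)
    (C := fun k => √((m + 1 : ℝ) * Real.log t / playCount I k t)) hw
    (fun k _ => by rw [hU]; linarith [(abs_le.1 (hdev k)).1])
    (fun k _ => by rw [hU]; linarith [(abs_le.1 (hdev k)).2]) hcmp
  have ht1 : (1 : ℝ) ≤ t := by exact_mod_cast (by omega : 1 ≤ t)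
  have hlog : Real.log t ≤ Real.log T :=
    Real.log_le_log (by linarith) (by exact_mod_cast hT.le)
  exact exists_le_of_le_sum hd (Finset.mem_filter.1 hgreedy.1).2 hom hw
    (mul_le_mul_of_nonneg_left hlog (by positivity))
    (mul_nonneg (by positivity) (Real.log_nonneg ht1)) (hgap.trans hle)

open Classical in
/-- Regret on a trajectory without alarms. -/
theorem sum_regret_le {μ : Fin K → ℝ} {om dmin dmax opt : ℝ} {J : Finset (Fin K)}
    (hK : 0 < K) (hW : IsDAG W) (h0 : ∀ i j, 0 ≤ W i j) (heps : 0 ≤ A.eps) (hc : ∀ k, 0 ≤ c k)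
    (hinit : InitAdmissible A m)
    (hid : ∀ t < T, (S t).col + 1 = K → ∀ V, IsGraphEstimate A.lam (S (t + 1)).data V → V = W)
    (hal : ∀ t < T, ∀ k, ¬ Alarm A (b (t + 1)) (I (t + 1)) (S t) k)
    (hom : ∀ t < T, K ≤ t → ∀ k ∈ I (t + 1), weight c W k ≤ om) (hJ : J ∈ feasible K m)
    (hopt : opt = ∑ k ∈ J, weight c W k * μ k) (hd : 0 < dmin)
    (hmin : ∀ t < T, ∑ k ∈ I (t + 1), weight c W k * μ k < opt →
      dmin ≤ opt - ∑ k ∈ I (t + 1), weight c W k * μ k)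
    (hmax : ∀ t < T, opt - ∑ k ∈ I (t + 1), weight c W k * μ k ≤ dmax) (hmax0 : 0 ≤ dmax) :
    ∑ t ∈ Finset.range T, (opt - ∑ k ∈ I (t + 1), weight c W k * μ k) ≤
      dmax * (K + K * (4 * om ^ 2 * m ^ 2 * ((m + 1) * Real.log T) / dmin ^ 2)
        + ∑ t ∈ Finset.range T, (if Forced (S t) then 1 else 0)
        + ∑ t ∈ Finset.Ico K T, ∑ k, if √((m + 1 : ℝ) * Real.log t / playCount I k t)
            < |playSum I b k t / playCount I k t - μ k| then 1 else 0) := by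
  set r : ℕ → ℝ := fun t => opt - ∑ k ∈ I (t + 1), weight c W k * μ k with hr
  set F : ℕ → ℝ := fun t => if Forced (S t) then 1 else 0 with hF
  set V : ℕ → Fin K → ℝ := fun t k => if √((m + 1 : ℝ) * Real.log t / playCount I k t)
    < |playSum I b k t / playCount I k t - μ k| then 1 else 0 with hV
  set L : ℝ := 4 * om ^ 2 * m ^ 2 * ((m + 1) * Real.log T) / dmin ^ 2 with hL
  have hL0 : 0 ≤ L := by
    have := Real.log_natCast_nonneg T
    positivity
  have hV0 : ∀ t k, 0 ≤ V t k := fun t k => by simp only [hV]; split_ifs <;> simp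
  have hF0 : ∀ t, 0 ≤ F t := fun t => by simp only [hF]; split_ifs <;> simp
  -- The rounds not excused by initialization, a forced play or a bad empirical mean; only these
  -- need the counting argument.
  set G : Finset ℕ := (Finset.Ico K T).filter fun t =>
    0 < r t ∧ ¬ Forced (S t) ∧ ∀ k, |playSum I b k t / playCount I k t - μ k|
      ≤ √((m + 1 : ℝ) * Real.log t / playCount I k t) with hG
  have hround : ∀ t ∈ Finset.range T, r t ≤ dmax * ((if t < K then 1 else 0)
      + (if t ∈ G then 1 else 0) + F t + if K ≤ t then ∑ k, V t k else 0) := by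
    intro t ht
    have ht' := Finset.mem_range.1 ht
    have h4 : 0 ≤ if K ≤ t then ∑ k, V t k else 0 := by
      split_ifs
      · exact Finset.sum_nonneg fun k _ => hV0 t k
      · exact le_rfl
    have h3 := hF0 t
    have h1 : (0 : ℝ) ≤ if t < K then 1 else 0 := by split_ifs <;> simp
    have h2 : (0 : ℝ) ≤ if t ∈ G then 1 else 0 := by split_ifs <;> simp
    by_cases hpos : 0 < r t
    · refine (hmax t ht').trans (le_mul_of_one_le_right hmax0 ?_)
      by_cases hc1 : t < K
      · rw [if_pos hc1] at h1 ⊢; linarith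
      by_cases hc2 : Forced (S t)
      · have : F t = 1 := if_pos hc2
        linarith
      by_cases hc3 : ∀ k, |playSum I b k t / playCount I k t - μ k|
          ≤ √((m + 1 : ℝ) * Real.log t / playCount I k t)
      · have : t ∈ G := Finset.mem_filter.2 ⟨Finset.mem_Ico.2 ⟨not_lt.1 hc1, ht'⟩, hpos, hc2, hc3⟩
        rw [if_pos this] at h2 ⊢; linarith
      · push Not at hc3
        obtain ⟨k, hk⟩ := hc3
        have h5 : V t k ≤ ∑ k, V t k :=
          Finset.single_le_sum (fun k _ => hV0 t k) (Finset.mem_univ k)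
        have h6 : V t k = 1 := if_pos hk
        rw [if_pos (not_lt.1 hc1)]; linarith
    · exact (not_lt.1 hpos).trans (mul_nonneg hmax0 (by linarith))
  have hinitial : ∑ t ∈ Finset.range T, (if t < K then (1 : ℝ) else 0) ≤ K := by
    rw [← Finset.sum_filter, Finset.sum_const, nsmul_one]
    have : ((Finset.range T).filter fun t => t < K) ⊆ Finset.range K := fun t ht =>
      Finset.mem_range.2 (Finset.mem_filter.1 ht).2
    simpa using (Nat.cast_le (α := ℝ)).2 (Finset.card_le_card this)
  have hgood : ∑ t ∈ Finset.range T, (if t ∈ G then (1 : ℝ) else 0) ≤ K * L := by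
    rw [← Finset.sum_filter, Finset.sum_const, nsmul_one]
    have hsub : ((Finset.range T).filter fun t => t ∈ G) ⊆ G := fun t ht =>
      (Finset.mem_filter.1 ht).2
    refine ((Nat.cast_le (α := ℝ)).2 (Finset.card_le_card hsub)).trans ?_
    rcases G.eq_empty_or_nonempty with he | ⟨t₁, ht₁⟩
    · rw [he]; simp only [Finset.card_empty, Nat.cast_zero]; positivity
    -- A round in `G` guarantees that the initialization is completed within the horizon.
    have hKT : K ≤ T := by
      have := Finset.mem_Ico.1 (Finset.mem_filter.1 ht₁).1
      omega
    refine card_le_of_playCount_le I K G (fun t ht => (Finset.mem_Ico.1 (Finset.mem_filter.1 ht).1).1)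
      (one_le_playCount hstart hstep hinit hKT) hL0 fun t ht => ?_
    obtain ⟨h1, h2, h3, h4⟩ := Finset.mem_filter.1 ht
    obtain ⟨h5, h6⟩ := Finset.mem_Ico.1 h1
    exact exists_playCount_le hstart hstep hK hW h0 heps hc hinit hid hal h5 h6 h3 h4
      (hom t h6 h5) hJ hd (by rw [← hopt]; exact hmin t h6 (sub_pos.1 h2))
  have hdev : ∑ t ∈ Finset.range T, (if K ≤ t then ∑ k, V t k else 0)
      = ∑ t ∈ Finset.Ico K T, ∑ k, V t k := by
    rw [← Finset.sum_filter]
    congr 1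
    ext t; simp [and_comm]
  calc ∑ t ∈ Finset.range T, r t ≤ _ := Finset.sum_le_sum hround
    _ = dmax * (∑ t ∈ Finset.range T, (if t < K then (1 : ℝ) else 0)
          + ∑ t ∈ Finset.range T, (if t ∈ G then (1 : ℝ) else 0) + ∑ t ∈ Finset.range T, F t
          + ∑ t ∈ Finset.Ico K T, ∑ k, V t k) := by
        rw [← Finset.mul_sum, Finset.sum_add_distrib, Finset.sum_add_distrib,
          Finset.sum_add_distrib, hdev]
    _ ≤ _ := by
        refine mul_le_mul_of_nonneg_left ?_ hmax0
        linarith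

end Trajectory

/-! ## Stationary environments -/

namespace Bandit

theorem W_eq_of_numGraphSegments {K : ℕ} {Ω : Type*} {E : Bandit K Ω} (hW : E.numGraphSegments = 1) {t : ℕ} (ht : t < E.T) :
    E.W (t + 1) = E.W 1 := by
  induction t with
  | zero => rfl
  | succ t ih =>
    rw [← ih (by omega)]
    unfold numGraphSegments at hW
    rw [Nat.add_eq_left, Finset.card_eq_zero, Finset.filter_eq_empty_iff] at hW
    have := hW (x := t + 1) (Finset.mem_Ico.2 ⟨by omega, by omega⟩)
    push Not at this
    exact this.symm

variable {K : ℕ} {Ω : Type*} [mΩ : MeasurableSpace Ω] {E : Bandit K Ω} {P : Measure Ω}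

open Classical in
theorem map_eq_of_numDistSegments (hΘ : E.numDistSegments P = 1) {t : ℕ} (ht : t < E.T)
    (k : Fin K) : P.map (fun ω => E.b (t + 1) ω k) = P.map (fun ω => E.b 1 ω k) := by
  induction t with
  | zero => rfl
  | succ t ih =>
    rw [← ih (by omega)]
    unfold numDistSegments at hΘ
    rw [Nat.add_eq_left, Finset.card_eq_zero, Finset.filter_eq_empty_iff] at hΘ
    have := hΘ (x := t + 1) (Finset.mem_Ico.2 ⟨by omega, by omega⟩)
    push Not at this
    exact (this k).symm

variable {ℱ : Filtration ℕ mΩ}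

theorem IsValid.measurable_b (hE : E.IsValid P ℱ) {t : ℕ} (ht : t ∈ Finset.Icc 1 E.T)
    (k : Fin K) : Measurable[ℱ t] fun ω => E.b t ω k :=
  (measurable_pi_apply k).comp (hE.b_adapted t ht)

/-- Equality of the one-arm marginal laws is enough, because expected payoffs are linear in the
means; the joint law of the arms may change. -/
theorem IsValid.integral_b_eq (hE : E.IsValid P ℱ) (hΘ : E.numDistSegments P = 1) {t : ℕ}
    (ht : t ∈ Finset.Icc 1 E.T) (k : Fin K) : ∫ ω, E.b t ω k ∂P = ∫ ω, E.b 1 ω k ∂P := by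
  obtain ⟨h1, h2⟩ := Finset.mem_Icc.1 ht
  have hm1 := ((hE.measurable_b (Finset.mem_Icc.2 ⟨le_rfl, h1.trans h2⟩) k).mono
    (ℱ.le 1) le_rfl).aemeasurable (μ := P)
  have hm := ((hE.measurable_b ht k).mono (ℱ.le t) le_rfl).aemeasurable (μ := P)
  obtain ⟨t, rfl⟩ : ∃ s, t = s + 1 := ⟨t - 1, by omega⟩
  have h := integral_map hm (f := id) aestronglyMeasurable_id
  rw [map_eq_of_numDistSegments hΘ h2, integral_map hm1 (f := id) aestronglyMeasurable_id] at h
  exact h.symm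

/-- Makes `gapMin` an attained, hence positive, infimum and `gapMax` a genuine upper bound. -/
theorem finite_gaps : (E.gaps P).Finite := by
  refine ((Finset.Icc 1 E.T ×ˢ feasible K E.m).image fun p =>
    E.optPayoff P p.1 - E.expPayoff P p.1 p.2).finite_toSet.subset ?_
  rintro d ⟨t, ht, J, hJ, -, rfl⟩
  exact Finset.mem_coe.2 (Finset.mem_image.2 ⟨(t, J), Finset.mem_product.2 ⟨ht, hJ⟩, rfl⟩)

theorem expPayoff_le_optPayoff (t : ℕ) {J : Finset (Fin K)} (hJ : J ∈ feasible K E.m) :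
    E.expPayoff P t J ≤ E.optPayoff P t :=
  Finset.le_sup' (E.expPayoff P t) hJ

theorem gapMin_pos (h : (E.gaps P).Nonempty) : 0 < E.gapMin P := by
  obtain ⟨t, -, J, -, hlt, hd⟩ := h.csInf_mem finite_gaps
  have : E.gapMin P = E.optPayoff P t - E.expPayoff P t J := hd
  linarith

theorem gapMax_nonneg : 0 ≤ E.gapMax P :=
  Real.sSup_nonneg fun d ⟨_, _, _, _, hlt, hd⟩ => by linarith

theorem gapMin_le {t : ℕ} (ht : t ∈ Finset.Icc 1 E.T) {J : Finset (Fin K)}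
    (hJ : J ∈ feasible K E.m) (h : E.expPayoff P t J < E.optPayoff P t) :
    E.gapMin P ≤ E.optPayoff P t - E.expPayoff P t J :=
  csInf_le finite_gaps.bddBelow ⟨t, ht, J, hJ, h, rfl⟩

theorem le_gapMax {t : ℕ} (ht : t ∈ Finset.Icc 1 E.T) {J : Finset (Fin K)}
    (hJ : J ∈ feasible K E.m) :
    E.optPayoff P t - E.expPayoff P t J ≤ E.gapMax P := by
  by_cases h : E.expPayoff P t J < E.optPayoff P t
  · exact le_csSup finite_gaps.bddAbove ⟨t, ht, J, hJ, h, rfl⟩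
  · linarith [gapMax_nonneg (E := E) (P := P)]

/-- A gap requires two distinct feasible super arms, whereas only the empty one exists if `m = 0` or
`K = 0`. -/
theorem one_le_m_of_gaps (h : (E.gaps P).Nonempty) : 1 ≤ E.m ∧ 1 ≤ K := by
  obtain ⟨-, t, -, J, hJ, hlt, -⟩ := h
  obtain ⟨J', hJ', hopt⟩ :=
    Finset.exists_mem_eq_sup' (feasible_nonempty K E.m) (E.expPayoff P t)
  have hne : J ≠ J' := by
    rintro rfl
    exact absurd hlt (by rw [optPayoff, hopt]; exact lt_irrefl _)
  constructor
  · by_contra hm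
    have h1 := (Finset.mem_filter.1 hJ).2
    have h2 := (Finset.mem_filter.1 hJ').2
    have h3 : J = ∅ := Finset.card_eq_zero.1 (by omega)
    have h4 : J' = ∅ := Finset.card_eq_zero.1 (by omega)
    exact hne (h3.trans h4.symm)
  · by_contra hK
    obtain rfl : K = 0 := by omega
    exact hne (Subsingleton.elim _ _)

variable [IsProbabilityMeasure P]

/-- Hoeffding's lemma on `[0, 1]`: the variance proxy is the square of half the length. -/
theorem IsValid.hasSubgaussianMGF (hE : E.IsValid P ℱ) (hΘ : E.numDistSegments P = 1) {t : ℕ}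
    (ht : t ∈ Finset.Icc 1 E.T) (k : Fin K) :
    HasSubgaussianMGF (fun ω => E.b t ω k - ∫ ω, E.b 1 ω k ∂P) (1 / 4) P := by
  rw [← hE.integral_b_eq hΘ ht k]
  have hm := ((hE.measurable_b ht k).mono (ℱ.le t) le_rfl).aemeasurable (μ := P)
  have h := hasSubgaussianMGF_of_mem_Icc (a := 0) (b := 1) hm
    ((hE.b_mem t ht).mono fun ω hω => hω k)
  convert h using 1
  simp only [sub_zero, nnnorm_one]
  norm_num

/-- The expected payoff is linear in the mean rewards of the base arms. -/
theorem IsValid.expPayoff_eq (hE : E.IsValid P ℱ) (hΘ : E.numDistSegments P = 1)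
    (hW : E.numGraphSegments = 1) {t : ℕ} (ht : t < E.T) (J : Finset (Fin K)) :
    E.expPayoff P (t + 1) J = ∑ k ∈ J, weight E.c (E.W 1) k * ∫ ω, E.b 1 ω k ∂P := by
  have hmem : t + 1 ∈ Finset.Icc 1 E.T := Finset.mem_Icc.2 ⟨by omega, ht⟩
  have hp : ∀ ω, E.payoff (t + 1) J ω = ∑ k ∈ J, weight E.c (E.W 1) k * E.b (t + 1) ω k := by
    intro ω
    rw [payoff, endoOutput, exoInput, W_eq_of_numGraphSegments hW ht, dotProduct_inv_mulVec]
  simp only [expPayoff, hp]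
  rw [integral_finsetSum]
  · exact Finset.sum_congr rfl fun k _ => by rw [integral_const_mul, hE.integral_b_eq hΘ hmem]
  · intro k _
    refine Integrable.const_mul (Integrable.of_mem_Icc 0 1 ?_ ?_) _
    · exact ((hE.measurable_b hmem k).mono (ℱ.le _) le_rfl).aemeasurable
    · exact (hE.b_mem _ hmem).mono fun ω hω => hω k

theorem sum_Icc_eq_sum_range (f : ℕ → ℝ) (T : ℕ) :
    ∑ t ∈ Finset.Icc 1 T, f t = ∑ t ∈ Finset.range T, f (t + 1) := by
  rw [Finset.range_eq_Ico, Finset.sum_Ico_add' f 0 T 1]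
  rfl

end Bandit

/-! ## The regret bound -/

section Regret

variable {K : ℕ} {Ω : Type*} [mΩ : MeasurableSpace Ω] {P : Measure Ω}
  {ℱ : Filtration ℕ mΩ} {E : Bandit K Ω} {A : Params K} {I : ℕ → Ω → Finset (Fin K)}
  {S : ℕ → Ω → State K}

/-- The event that after round `s` the empirical mean of arm `k` over the whole history is outside
its confidence interval. -/
def deviationEvent (E : Bandit K Ω) (P : Measure Ω) (I : ℕ → Ω → Finset (Fin K)) (s : ℕ)
    (k : Fin K) : Set Ω :=
  {ω | 0 < playCount (fun t => I t ω) k s ∧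
    √((E.m + 1 : ℝ) * Real.log s / playCount (fun t => I t ω) k s) <
      |playSum (fun t => I t ω) (fun t => E.b t ω) k s / playCount (fun t => I t ω) k s
        - ∫ ω, E.b 1 ω k ∂P|}

/-- The almost sure properties of a run in terms of the initial graph. -/
theorem ae_trajectory (hW : E.numGraphSegments = 1) (hrun : IsRun A E P ℱ I S)
    (hid : GraphIdentified A E P S) : ∀ᵐ ω ∂P, S 0 ω = State.initial K ∧
      (∀ t < E.T, Step A E.m E.c (t + 1) (E.W 1) (E.b (t + 1) ω) (I (t + 1) ω) (S t ω)
        (S (t + 1) ω)) ∧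
      ∀ t < E.T, (S t ω).col + 1 = K →
        ∀ V, IsGraphEstimate A.lam (S (t + 1) ω).data V → V = E.W 1 := by
  filter_upwards [hrun.start, hrun.step, hid] with ω h1 h2 h3
  refine ⟨h1, fun t ht => ?_, fun t ht => ?_⟩
  · rw [← Bandit.W_eq_of_numGraphSegments hW ht]; exact h2 t ht
  · rw [← Bandit.W_eq_of_numGraphSegments hW ht]; exact h3 t ht

/-- Indicator of a measurable superset of the same measure. -/
noncomputable def hullIndicator (P : Measure Ω) (s : Set Ω) : Ω → ℝ :=
  (toMeasurable P s).indicator fun _ => 1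

theorem hullIndicator_nonneg (s : Set Ω) (ω : Ω) : 0 ≤ hullIndicator P s ω :=
  Set.indicator_nonneg (fun _ _ => zero_le_one) ω

theorem hullIndicator_of_mem {s : Set Ω} {ω : Ω} (h : ω ∈ s) : hullIndicator P s ω = 1 :=
  Set.indicator_of_mem (subset_toMeasurable P s h) _

/-- The memory `S` is not assumed measurable, so forced plays and alarms need not be measurable
events. The hull dominates the indicator pointwise, yet its integral is the (outer) measure in the
statement. -/
theorem integral_hullIndicator (s : Set Ω) : ∫ ω, hullIndicator P s ω ∂P = P.real s := by
  rw [hullIndicator, integral_indicator_const _ (measurableSet_toMeasurable P s), Measure.real,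
    measure_toMeasurable]
  simp [Measure.real]

/-- Once the estimate equals the true matrix, the entries in `omegaMax` are the true weights of the
played arms. -/
theorem ae_weight_le_omegaMax (hE : E.IsValid P ℱ) (hW : E.numGraphSegments = 1)
    (heps : 0 ≤ A.eps) (hK : 1 ≤ K)
    (hrun : IsRun A E P ℱ I S) (hid : GraphIdentified A E P S) :
    ∀ᵐ ω ∂P, ∀ t < E.T, K ≤ t → ∀ k ∈ I (t + 1) ω, weight E.c (E.W 1) k ≤ omegaMax E P I S := by
  rcases Nat.eq_zero_or_pos E.T with hT0 | hT0
  · exact Filter.Eventually.of_forall fun ω t ht => by omega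
  have h1T : 1 ∈ Finset.Icc 1 E.T := Finset.mem_Icc.2 ⟨le_rfl, hT0⟩
  have hest : ∀ᵐ ω ∂P, ∀ t ∈ Finset.Ioc K E.T, (S (t - 1) ω).What = E.W 1 := by
    filter_upwards [ae_trajectory hW hrun hid] with ω ⟨h1, h2, h3⟩ t ht
    obtain ⟨h4, h5⟩ := Finset.mem_Ioc.1 ht
    exact (estimate_eq (S := fun t => S t ω) (I := fun t => I t ω) (b := fun t => E.b t ω) h1 h2 hK
      (hE.W_dag 1 h1T) (hE.W_nonneg 1 h1T) heps h3 (by omega) (by omega)).2.1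
  have hentry : ∀ᵐ ω ∂P, ∀ t ∈ Finset.Ioc K E.T, ∀ k,
      ((E.c ᵥ* (1 - (S (t - 1) ω).What)⁻¹) ᵥ* Matrix.diagonal (vec (I t ω))) k
        = if k ∈ I t ω then weight E.c (E.W 1) k else 0 := by
    filter_upwards [hest] with ω hω t ht k
    rw [hω t ht, Matrix.vecMul_diagonal, vec, weight]
    simp
  -- A real-valued `essSup` dominates its function only under a boundedness condition; any crude
  -- bound does.
  have hbdd : Filter.IsBoundedUnder (· ≤ ·) (ae P) fun ω =>
      ⨆ t : Finset.Ioc K E.T, ⨆ k : Fin K,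
        ((E.c ᵥ* (1 - (S (t - 1) ω).What)⁻¹) ᵥ* Matrix.diagonal (vec (I t ω))) k := by
    refine Filter.isBoundedUnder_of_eventually_le (a := ∑ k, |weight E.c (E.W 1) k|) ?_
    filter_upwards [hentry] with ω hω
    have h0 : 0 ≤ ∑ k, |weight E.c (E.W 1) k| := Finset.sum_nonneg fun k _ => abs_nonneg _
    refine Real.iSup_le (fun t => Real.iSup_le (fun k => ?_) h0) h0
    rw [hω t t.2 k]
    split_ifs
    · exact (le_abs_self _).trans (Finset.single_le_sum
        (f := fun k => |weight E.c (E.W 1) k|) (fun k _ => abs_nonneg _) (Finset.mem_univ k))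
    · exact h0
  filter_upwards [hentry, ae_le_essSup hbdd] with ω hω hle t ht hKt k hk
  have hmem : t + 1 ∈ Finset.Ioc K E.T := Finset.mem_Ioc.2 ⟨by omega, by omega⟩
  refine le_trans ?_ hle
  refine le_trans ?_ (Finite.le_ciSup _ (⟨t + 1, hmem⟩ : Finset.Ioc K E.T))
  refine le_trans ?_ (Finite.le_ciSup _ k)
  rw [hω (t + 1) hmem k, if_pos hk]

variable [IsProbabilityMeasure P]

theorem measureReal_deviationEvent_le (hE : E.IsValid P ℱ) (hΘ : E.numDistSegments P = 1)
    (hpred : ∀ t < E.T, ∀ J, MeasurableSet[ℱ t] {ω | I (t + 1) ω = J}) (hm : 1 ≤ E.m) {s : ℕ}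
    (hs1 : 1 ≤ s) (hs : s ≤ E.T) (k : Fin K) :
    P.real (deviationEvent E P I s k) ≤ 2 * (1 / (s : ℝ) ^ 2) := by
  classical
  set μ := ∫ ω, E.b 1 ω k ∂P with hμ
  set D : ℕ → Set Ω := fun t => {ω | k ∈ I t ω} with hD
  set Y : ℕ → Ω → ℝ := fun t ω => E.b t ω k - μ with hY
  have hDm : ∀ t < E.T, MeasurableSet[ℱ t] (D (t + 1)) := by
    intro t ht
    have : D (t + 1) = ⋃ J ∈ Finset.univ.filter (fun J : Finset (Fin K) => k ∈ J),
        {ω | I (t + 1) ω = J} := by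
      ext ω; simp [hD]
    rw [this]
    exact Finset.measurableSet_biUnion _ fun J _ => hpred t ht J
  have hYm : ∀ t ∈ Finset.Icc 1 E.T, Measurable[ℱ t] (Y t) := fun t ht =>
    (hE.measurable_b ht k).sub_const μ
  have hind : ∀ t < E.T,
      Indep (MeasurableSpace.comap (Y (t + 1)) inferInstance) (ℱ t) P := by
    intro t ht
    refine indep_of_indep_of_le_left (hE.b_indep t ht) ?_
    have h1 : Measurable fun x : Fin K → ℝ => x k - μ := by fun_prop
    exact (h1.comp (comap_measurable (E.b (t + 1)))).comap_le
  have hs1' : (1 : ℝ) ≤ s := by exact_mod_cast hs1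
  have hlog : 0 ≤ Real.log s := Real.log_nonneg hs1'
  have hbound := measureReal_abs_selSum_le (P := P) hYm hind
    (fun t ht => hE.hasSubgaussianMGF hΘ ht k) hDm
    (v := (E.m + 1 : ℝ) * Real.log s) (by positivity) hs
  have hcount : ∀ ω, selCount D s ω = playCount (fun t => I t ω) k s := fun ω =>
    selCount_eq_card D s ω
  have hsum : ∀ ω, selSum Y D s ω = playSum (fun t => I t ω) (fun t => E.b t ω) k s
      - playCount (fun t => I t ω) k s * μ := by
    intro ω
    rw [← hcount, selSum, playSum, selCount, Finset.sum_mul, ← Finset.sum_sub_distrib]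
    refine Finset.sum_congr rfl fun i _ => ?_
    by_cases h : k ∈ I (i + 1) ω
    · rw [Set.indicator_of_mem (show ω ∈ D (i + 1) from h),
        Set.indicator_of_mem (show ω ∈ D (i + 1) from h), if_pos h, one_mul]
    · rw [Set.indicator_of_notMem (show ω ∉ D (i + 1) from h),
        Set.indicator_of_notMem (show ω ∉ D (i + 1) from h), if_neg h]
      simp
  have hset : deviationEvent E P I s k =
      {ω | 0 < selCount D s ω ∧ √((E.m + 1 : ℝ) * Real.log s / selCount D s ω)
        < |selSum Y D s ω / selCount D s ω|} := by
    ext ω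
    simp only [deviationEvent, Set.mem_ofPred_eq, hcount, hsum, Nat.cast_pos]
    refine and_congr_right fun h => ?_
    have h' : (playCount (fun t => I t ω) k s : ℝ) ≠ 0 := by exact_mod_cast h.ne'
    rw [sub_div, mul_div_cancel_left₀ _ h']
  rw [hset]
  refine hbound.trans ?_
  -- Since `m ≥ 1`, the exponent `2 * (m + 1)` is at least `3`; one power pays for the union over
  -- sample sizes, and `s⁻²` remains.
  have hexp : Real.exp (-2 * ((E.m + 1 : ℝ) * Real.log s)) ≤ 1 / (s : ℝ) ^ 3 := by
    rw [one_div, ← Real.exp_log (show (0 : ℝ) < (s : ℝ) ^ 3 by positivity), ← Real.exp_neg,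
      Real.log_pow]
    refine Real.exp_le_exp.2 ?_
    have hm' : (1 : ℝ) ≤ E.m := by exact_mod_cast hm
    push_cast
    nlinarith
  calc 2 * (s : ℝ) * Real.exp (-2 * ((E.m + 1 : ℝ) * Real.log s))
      ≤ 2 * (s : ℝ) * (1 / (s : ℝ) ^ 3) := mul_le_mul_of_nonneg_left hexp (by positivity)
    _ = 2 * (1 / (s : ℝ) ^ 2) := by field_simp

theorem sum_measureReal_deviationEvent_le (hE : E.IsValid P ℱ) (hΘ : E.numDistSegments P = 1)
    (hpred : ∀ t < E.T, ∀ J, MeasurableSet[ℱ t] {ω | I (t + 1) ω = J}) (hm : 1 ≤ E.m)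
    (hK : 1 ≤ K) :
    ∑ t ∈ Finset.Ico K E.T, ∑ k, P.real (deviationEvent E P I t k)
      ≤ Real.pi ^ 2 / 3 * E.m * K := by
  have hm' : (1 : ℝ) ≤ E.m := by exact_mod_cast hm
  calc ∑ t ∈ Finset.Ico K E.T, ∑ k, P.real (deviationEvent E P I t k)
      ≤ ∑ t ∈ Finset.Ico K E.T, ∑ _k : Fin K, 2 * (1 / (t : ℝ) ^ 2) := by
        refine Finset.sum_le_sum fun t ht => Finset.sum_le_sum fun k _ => ?_
        obtain ⟨h1, h2⟩ := Finset.mem_Ico.1 ht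
        exact measureReal_deviationEvent_le hE hΘ hpred hm (by omega) h2.le k
    _ = K * 2 * ∑ t ∈ Finset.Ico K E.T, 1 / (t : ℝ) ^ 2 := by
        rw [Finset.mul_sum]
        exact Finset.sum_congr rfl fun t _ => by simp; ring
    _ ≤ K * 2 * (Real.pi ^ 2 / 6) := by
        refine mul_le_mul_of_nonneg_left ?_ (by positivity)
        exact sum_le_hasSum _ (fun t _ => by positivity) hasSum_zeta_two
    _ = Real.pi ^ 2 / 3 * 1 * K := by ring
    -- The factor `m` is slack, added to match the stated bound.
    _ ≤ Real.pi ^ 2 / 3 * E.m * K := by gcongr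

theorem integrable_hullIndicator (s : Set Ω) : Integrable (hullIndicator P s) P :=
  (integrable_const 1).indicator (measurableSet_toMeasurable P s)

theorem ae_sum_regret_le (hE : E.IsValid P ℱ) (hΘ : E.numDistSegments P = 1)
    (hW : E.numGraphSegments = 1) (heps : 0 ≤ A.eps) (hinit : InitAdmissible A E.m)
    (hrun : IsRun A E P ℱ I S) (hid : GraphIdentified A E P S) (hgaps : (E.gaps P).Nonempty) :
    ∀ᵐ ω ∂P, ∑ t ∈ Finset.range E.T, (E.optPayoff P (t + 1) - E.expPayoff P (t + 1) (I (t + 1) ω))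
      ≤ E.gapMax P * (K + K * (4 * omegaMax E P I S ^ 2 * E.m ^ 2 * ((E.m + 1) * Real.log E.T)
          / E.gapMin P ^ 2)
        + ∑ t ∈ Finset.range E.T, hullIndicator P (forcedEvent S (t + 1)) ω
        + ∑ t ∈ Finset.Ico K E.T, ∑ k, hullIndicator P (deviationEvent E P I t k) ω
        + E.T * hullIndicator P (alarmEvent A E I S) ω) := by
  classical
  obtain ⟨hm, hK⟩ := Bandit.one_le_m_of_gaps hgaps
  have hT : 1 ≤ E.T := by
    obtain ⟨-, t, ht, -⟩ := hgaps
    have := Finset.mem_Icc.1 ht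
    omega
  have h1T : 1 ∈ Finset.Icc 1 E.T := Finset.mem_Icc.2 ⟨le_rfl, hT⟩
  have hIcc : ∀ t < E.T, t + 1 ∈ Finset.Icc 1 E.T := fun t ht =>
    Finset.mem_Icc.2 ⟨by omega, ht⟩
  have hmax0 : 0 ≤ E.gapMax P := Bandit.gapMax_nonneg
  have hc : ∀ k, 0 ≤ E.c k := fun k => by rcases hE.c_mem k with h | h <;> simp [h]
  have hlogT := Real.log_natCast_nonneg E.T
  obtain ⟨J, hJ, hJopt⟩ :=
    Finset.exists_mem_eq_sup' (feasible_nonempty K E.m) (E.expPayoff P 1)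
  have hexp1 : ∀ t < E.T, E.expPayoff P (t + 1) = E.expPayoff P 1 := fun t ht => by
    funext J
    rw [hE.expPayoff_eq hΘ hW ht, ← hE.expPayoff_eq hΘ hW (t := 0) hT]
  have hopt : ∀ t < E.T, E.optPayoff P (t + 1)
      = ∑ k ∈ J, weight E.c (E.W 1) k * ∫ ω, E.b 1 ω k ∂P := fun t ht => by
    rw [Bandit.optPayoff, hexp1 t ht, hJopt, hE.expPayoff_eq hΘ hW (t := 0) hT]
  filter_upwards [ae_trajectory hW hrun hid, ae_weight_le_omegaMax hE hW heps hK hrun hid]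
    with ω ⟨h1, h2, h3⟩ hom
  have hfeas : ∀ t < E.T, I (t + 1) ω ∈ feasible K E.m := fun t ht => (h2 t ht).mem_feasible hinit
  have hN1 : 0 ≤ ∑ t ∈ Finset.range E.T, hullIndicator P (forcedEvent S (t + 1)) ω :=
    Finset.sum_nonneg fun t _ => hullIndicator_nonneg _ _
  have hN2 : 0 ≤ ∑ t ∈ Finset.Ico K E.T, ∑ k, hullIndicator P (deviationEvent E P I t k) ω :=
    Finset.sum_nonneg fun t _ => Finset.sum_nonneg fun k _ => hullIndicator_nonneg _ _
  have hN3 : 0 ≤ (K : ℝ) * (4 * omegaMax E P I S ^ 2 * E.m ^ 2 * ((E.m + 1) * Real.log E.T)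
      / E.gapMin P ^ 2) := by positivity
  have hN4 := hullIndicator_nonneg (P := P) (alarmEvent A E I S) ω
  -- On the alarm event the hull term alone pays for all `T` rounds at the maximal gap.
  by_cases hal : ω ∈ alarmEvent A E I S
  · rw [hullIndicator_of_mem hal]
    calc _ ≤ ∑ _t ∈ Finset.range E.T, E.gapMax P := Finset.sum_le_sum fun t ht =>
          Bandit.le_gapMax (hIcc t (Finset.mem_range.1 ht)) (hfeas t (Finset.mem_range.1 ht))
      _ = E.gapMax P * E.T := by simp [mul_comm]
      _ ≤ _ := by
          refine mul_le_mul_of_nonneg_left ?_ hmax0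
          have : (0 : ℝ) ≤ K := by positivity
          linarith
  · have hal' : ∀ t < E.T, ∀ k, ¬ Alarm A (E.b (t + 1) ω) (I (t + 1) ω) (S t ω) k :=
      fun t ht k hk => hal ⟨t, ht, k, hk⟩
    have hreg : ∀ t < E.T, E.optPayoff P (t + 1) - E.expPayoff P (t + 1) (I (t + 1) ω)
        = ∑ k ∈ J, weight E.c (E.W 1) k * ∫ ω, E.b 1 ω k ∂P
          - ∑ k ∈ I (t + 1) ω, weight E.c (E.W 1) k * ∫ ω, E.b 1 ω k ∂P := fun t ht => by
      rw [hopt t ht, hE.expPayoff_eq hΘ hW ht]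
    have hpath := sum_regret_le (S := fun t => S t ω) (I := fun t => I t ω)
      (b := fun t => E.b t ω) (μ := fun k => ∫ ω, E.b 1 ω k ∂P) (dmax := E.gapMax P) h1 h2 hK
      (hE.W_dag 1 h1T) (hE.W_nonneg 1 h1T) heps hc hinit h3 hal' hom hJ rfl
      (Bandit.gapMin_pos hgaps)
      (fun t ht hlt => by
        rw [← hreg t ht]
        refine Bandit.gapMin_le (hIcc t ht) (hfeas t ht) ?_
        rw [← sub_pos, hreg t ht]
        exact sub_pos.2 hlt)
      (fun t ht => by
        rw [← hreg t ht]
        exact Bandit.le_gapMax (hIcc t ht) (hfeas t ht)) hmax0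
    rw [Finset.sum_congr rfl fun t ht => hreg t (Finset.mem_range.1 ht)]
    refine hpath.trans (mul_le_mul_of_nonneg_left ?_ hmax0)
    have hF : ∑ t ∈ Finset.range E.T, (if Forced (S t ω) then (1 : ℝ) else 0)
        ≤ ∑ t ∈ Finset.range E.T, hullIndicator P (forcedEvent S (t + 1)) ω := by
      refine Finset.sum_le_sum fun t _ => ?_
      split_ifs with h
      · exact (hullIndicator_of_mem (P := P) (s := forcedEvent S (t + 1)) h).ge
      · exact hullIndicator_nonneg _ _
    have hV : ∑ t ∈ Finset.Ico K E.T, ∑ k, (if √((E.m + 1 : ℝ) * Real.log t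
          / playCount (fun t => I t ω) k t)
          < |playSum (fun t => I t ω) (fun t => E.b t ω) k t / playCount (fun t => I t ω) k t
            - ∫ ω, E.b 1 ω k ∂P| then (1 : ℝ) else 0)
        ≤ ∑ t ∈ Finset.Ico K E.T, ∑ k, hullIndicator P (deviationEvent E P I t k) ω := by
      refine Finset.sum_le_sum fun t ht => Finset.sum_le_sum fun k _ => ?_
      obtain ⟨h4, h5⟩ := Finset.mem_Ico.1 ht
      split_ifs with h
      · refine (hullIndicator_of_mem (P := P) (s := deviationEvent E P I t k) ⟨?_, h⟩).ge
        -- `deviationEvent` requires a positive count, which holds from time `K` on.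
        exact (one_le_playCount (S := fun t => S t ω) (I := fun t => I t ω)
          (b := fun t => E.b t ω) h1 h2 hinit (by omega) k).trans (playCount_mono _ k h4)
      · exact hullIndicator_nonneg _ _
    have : 0 ≤ (E.T : ℝ) * hullIndicator P (alarmEvent A E I S) ω := by positivity
    linarith

theorem regret_le (hE : E.IsValid P ℱ) (hΘ : E.numDistSegments P = 1)
    (hW : E.numGraphSegments = 1) (heps : 0 ≤ A.eps) (hinit : InitAdmissible A E.m)
    (hrun : IsRun A E P ℱ I S) (hid : GraphIdentified A E P S) :
    E.regret P I ≤ (stationaryBound E P I S + ∑ t ∈ Finset.Icc 1 E.T, P.real (forcedEvent S t)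
      + E.T * P.real (alarmEvent A E I S)) * E.gapMax P := by
  have hfeas : ∀ᵐ ω ∂P, ∀ t < E.T, I (t + 1) ω ∈ feasible K E.m := by
    filter_upwards [hrun.step] with ω h t ht using (h t ht).mem_feasible hinit
  have hIcc : ∀ t < E.T, t + 1 ∈ Finset.Icc 1 E.T := fun t ht =>
    Finset.mem_Icc.2 ⟨by omega, ht⟩
  simp only [Bandit.regret, Bandit.sum_Icc_eq_sum_range]
  rcases (E.gaps P).eq_empty_or_nonempty with hgaps | hgaps
  -- Without suboptimal super arms `gapMax` is `sSup ∅ = 0`, so the right-hand side vanishes and the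
  -- regret must be shown nonpositive.
  · have h0 : E.gapMax P = 0 := by rw [Bandit.gapMax, hgaps, Real.sSup_empty]
    rw [h0, mul_zero]
    refine integral_nonpos_of_ae ?_
    filter_upwards [hfeas] with ω hω
    refine Finset.sum_nonpos fun t ht => ?_
    have ht' := Finset.mem_range.1 ht
    exact (Bandit.le_gapMax (hIcc t ht') (hω t ht')).trans h0.le
  · obtain ⟨hm, hK⟩ := Bandit.one_le_m_of_gaps hgaps
    set B : ℝ := K + K * (4 * omegaMax E P I S ^ 2 * E.m ^ 2 * ((E.m + 1) * Real.log E.T)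
      / E.gapMin P ^ 2) with hB
    have hi1 : Integrable (fun ω => ∑ t ∈ Finset.range E.T,
        hullIndicator P (forcedEvent S (t + 1)) ω) P :=
      integrable_finsetSum _ fun t _ => integrable_hullIndicator _
    have hi2 : Integrable (fun ω => ∑ t ∈ Finset.Ico K E.T, ∑ k,
        hullIndicator P (deviationEvent E P I t k) ω) P :=
      integrable_finsetSum _ fun t _ => integrable_finsetSum _ fun k _ =>
        integrable_hullIndicator _
    have hi3 : Integrable (fun ω => (E.T : ℝ) * hullIndicator P (alarmEvent A E I S) ω) P :=
      (integrable_hullIndicator _).const_mul _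
    have hi01 : Integrable (fun ω => B + ∑ t ∈ Finset.range E.T,
        hullIndicator P (forcedEvent S (t + 1)) ω) P := (integrable_const B).add hi1
    have hi012 : Integrable (fun ω => B
        + ∑ t ∈ Finset.range E.T, hullIndicator P (forcedEvent S (t + 1)) ω
        + ∑ t ∈ Finset.Ico K E.T, ∑ k, hullIndicator P (deviationEvent E P I t k) ω) P :=
      hi01.add hi2
    have hint : ∫ ω, (B + ∑ t ∈ Finset.range E.T, hullIndicator P (forcedEvent S (t + 1)) ω
        + ∑ t ∈ Finset.Ico K E.T, ∑ k, hullIndicator P (deviationEvent E P I t k) ω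
        + E.T * hullIndicator P (alarmEvent A E I S) ω) ∂P
        = B + ∑ t ∈ Finset.range E.T, P.real (forcedEvent S (t + 1))
          + ∑ t ∈ Finset.Ico K E.T, ∑ k, P.real (deviationEvent E P I t k)
          + E.T * P.real (alarmEvent A E I S) := by
      rw [integral_add hi012 hi3, integral_add hi01 hi2,
        integral_add (integrable_const B) hi1, integral_const_mul,
        integral_finsetSum _ fun t _ => integrable_hullIndicator _,
        integral_finsetSum _ fun t _ => integrable_finsetSum _ fun k _ =>
          integrable_hullIndicator _]
      simp only [integral_finsetSum _ fun k _ => integrable_hullIndicator _,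
        integral_hullIndicator, integral_const, probReal_univ, one_smul]
    have hle : ∫ ω, ∑ t ∈ Finset.range E.T,
        (E.optPayoff P (t + 1) - E.expPayoff P (t + 1) (I (t + 1) ω)) ∂P
        ≤ ∫ ω, E.gapMax P * (B + ∑ t ∈ Finset.range E.T, hullIndicator P (forcedEvent S (t + 1)) ω
          + ∑ t ∈ Finset.Ico K E.T, ∑ k, hullIndicator P (deviationEvent E P I t k) ω
          + E.T * hullIndicator P (alarmEvent A E I S) ω) ∂P := by
      -- Nonnegativity of the regret, from feasibility of the plays, replaces its integrability.
      refine integral_mono_of_nonneg ?_ ((hi012.add hi3).const_mul _)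
        (ae_sum_regret_le hE hΘ hW heps hinit hrun hid hgaps)
      filter_upwards [hfeas] with ω hω
      exact Finset.sum_nonneg fun t ht => sub_nonneg.2
        (Bandit.expPayoff_le_optPayoff _ (hω t (Finset.mem_range.1 ht)))
    rw [integral_const_mul, hint] at hle
    refine hle.trans ?_
    rw [mul_comm]
    refine mul_le_mul_of_nonneg_right ?_ Bandit.gapMax_nonneg
    have hdev := sum_measureReal_deviationEvent_le hE hΘ hrun.predictable hm hK
    have hBeq : B + Real.pi ^ 2 / 3 * E.m * K = stationaryBound E P I S := by
      rw [hB, stationaryBound]; ring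
    linarith

end Regret

end SemBandit

open SemBandit in
theorem lemma1 {K : ℕ} {Ω : Type*} [MeasurableSpace Ω] (P : Measure Ω) [IsProbabilityMeasure P]
    (ℱ : Filtration ℕ ‹MeasurableSpace Ω›) (E : Bandit K Ω) (A : Params K)
    (I : ℕ → Ω → Finset (Fin K)) (S : ℕ → Ω → State K)
    (hE : E.IsValid P ℱ)
    (hΘ : E.numDistSegments P = 1) (hW : E.numGraphSegments = 1)
    (hlam : 0 ≤ A.lam) (heps : 0 ≤ A.eps) (hinit : InitAdmissible A E.m)
    (hrun : IsRun A E P ℱ I S) (hid : GraphIdentified A E P S) :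
    (P (alarmEvent A E I S) = 0 → (∀ t ∈ Finset.Icc 1 E.T, P (forcedEvent S t) = 0) →
      E.regret P I ≤ stationaryBound E P I S * E.gapMax P) ∧
    E.regret P I ≤
      (stationaryBound E P I S
        + ∑ t ∈ Finset.Icc 1 E.T, P.real (forcedEvent S t)
        + E.T * P.real (alarmEvent A E I S)) * E.gapMax P := by
  have hbound := regret_le hE hΘ hW heps hinit hrun hid
  refine ⟨fun halarm hforced => hbound.trans_eq ?_, hbound⟩
  rw [Measure.real, halarm, Finset.sum_eq_zero fun t ht => by rw [Measure.real, hforced t ht]; rfl]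
  simp
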